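/- Let $H,H'\in(0,1)$ and let $X_1=\{X_1(t)\}_{0\le t\le 1}$, $X_2=\{X_2(t)\}_{0\le t\le 1}$ be independent (continuous, centred) fractional Brownian motions on $[0,1]$ with Hurst parameters $H$ and $H'$, that is, with covariance functions $$R_1(s,t)=\tfrac12\big(s^{2H}+t^{2H}-|s-t|^{2H}\big),\qquad R_2(s,t)=\tfrac12\big(s^{2H'}+t^{2H'}-|s-t|^{2H'}\big).$$ **Notation.** A function $f$ on $[0,1]^2$ has finite $p$-variation ($p\ge1$) if $\sup_{D,D'}\sum_{k,l}|f(t_{k+1},t'_{l+1})-f(t_{k+1},t'_l)-f(t_k,t'_{l+1})+f(t_k,t'_l)|^p<\infty$, the supremum being over all partitions $D=\{t_k\}$, $D'=\{t'_l\}$ of $[0,1]$. Let $\mathcal E_2$ be the space of step functions $f(t,i)$ on $[0,1]\times\{1,2\}$ (linear combinations of $\mathbf 1_{(a,b]}$ in $t$ for each $i$) with $\langle f,g\rangle=\sum_{i=1}^2\iint f(s,i)g(t,i)\,dR_i(s,t)$, where $\iint_{(0,u]\times(0,v]}dR_i=R_i(u,v)$. Let $\mathcal H$ be the completion of $\mathcal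 E_2$, $\mathcal H^{\otimes2}$ its Hilbert tensor square and $\mathcal H^{\odot2}$ the subspace of symmetric tensors. Let $W$ be the isonormal Gaussian process on $\mathcal H$ extending isometrically $f\mapsto X_1(f(\cdot,1))+X_2(f(\cdot,2))$, where $X_i(\mathbf 1_{(a,b]})=X_i(b)-X_i(a)$, and let $I_2$ be the double Wiener–Itô integral with respect to $W$, i.e. the continuous linear map with $I_2(x\otimes y)=W(x)W(y)-\langle x,y\rangle$. The Lévy kernel is $f^{\mathcal L}_{11}=f^{\mathcal L}_{22}=0$, $f^{\mathcal L}_{12}(s,t)=\frac12(\mathbf 1_{s<t}-\mathbf 1_{s>t})$, $f^{\mathcal L}_{21}=-f^{\mathcal L}_{12}$. A *generalised Lévy area* of $X_1,X_2$ is a random variable $I_2(\hat f)$, where $\hat f\in\mathcal H^{\odot2}$ satisfies $$\langle\hat f,g\rangle_{\mathcal H^{\otimes2}}=\sum_{i,j=1}^2\iint_{[0,1]^2}\Big(\iint_{[0,1]^2}f^{\mathcal L}_{ij}(s,u)\,g_{ij}(t,v)\,dR_i(s,t)\Big)dR_j(u,v)\qquad\text{for all } g\in\mathcal E_2^{\otimes2},$$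 all the integrals existing as iterated Riemann–Stieltjes integrals (limits of Riemann–Stieltjes sums over product partitions as the meshes tend to $0$). **Statement.** 1. $R_1$ has finite $\max(1,\frac1{2H})$-variation and $R_2$ has finite $\max(1,\frac1{2H'})$-variation. For $p=\max(1,\frac1{2H})$ and $q=\max(1,\frac1{2H'})$, the condition $p^{-1}+q^{-1}>1$ holds if and only if $H+H'>\frac12$. 2. Whenever $p,q\ge1$ are such that $R_1$ has finite $p$-variation, $R_2$ has finite $q$-variation and $p^{-1}+q^{-1}>1$, a generalised Lévy area of $X_1,X_2$ exists. 3. Consequently a generalised Lévy area exists if $H+H'>\frac12$; in particular it exists if $H=H'>\frac14$. 4. One of the processes may be arbitrarily irregular if the other is regular enough: for every $H<\frac12$, however small, a generalised Lévy area exists as soon as $H'>\frac12-H$. -/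

import Mathlib

open MeasureTheory ProbabilityTheory
open scoped TensorProduct InnerProductSpace ENNReal

namespace LevyArea

noncomputable section

/-- The time interval `[0,1]`. -/
abbrev Time : Type := Set.Icc (0 : ℝ) 1

/-! ### Partitions, two-dimensional `p`-variation, Riemann-Stieltjes integrals -/

/-- A partition `0 = t₀ ≤ t₁ ≤ … ≤ tₙ = 1` of `[0,1]`. (Repeated points are harmless: they only
produce degenerate rectangles, on which every rectangular increment vanishes.) -/
structure Partition where
  n : ℕ
  pt : ℕ → Time
  mono : Monotone pt
  first : pt 0 = 0
  last : pt n = 1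

/-- The mesh of the partition is smaller than `δ`. -/
def Partition.MeshLT (D : Partition) (δ : ℝ) : Prop :=
  ∀ k < D.n, (D.pt (k + 1) : ℝ) - D.pt k < δ

/-- `ν k` belongs to the `k`-th closed interval of the partition. -/
def Partition.IsTag (D : Partition) (ν : ℕ → Time) : Prop :=
  ∀ k < D.n, D.pt k ≤ ν k ∧ ν k ≤ D.pt (k + 1)

/-- The rectangular increment of `f` over `[s,s'] × [t,t']`. -/
def rect (f : Time → Time → ℝ) (s s' t t' : Time) : ℝ :=
  f s' t' - f s' t - f s t' + f s t

/-- The rectangular increment over the cell with indices `k`, `l` of the grid `D × D'`. -/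
def cell (f : Time → Time → ℝ) (D D' : Partition) (k l : ℕ) : ℝ :=
  rect f (D.pt k) (D.pt (k + 1)) (D'.pt l) (D'.pt (l + 1))

/-- The two-dimensional `p`-variation of `f` over `[0,1]²`. -/
def pVariation (p : ℝ) (f : Time → Time → ℝ) : ℝ≥0∞ :=
  ⨆ (D : Partition) (D' : Partition),
    (∑ k ∈ Finset.range D.n, ∑ l ∈ Finset.range D'.n,
      ENNReal.ofReal (|cell f D D' k l| ^ p)) ^ (1 / p)

/-- `f` has finite two-dimensional `p`-variation on `[0,1]²`. -/
def HasFinitePVariation (p : ℝ) (f : Time → Time → ℝ) : Prop :=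
  pVariation p f < ⊤

/-- The Riemann-Stieltjes integral `∬_{[0,1]²} f(s,t) dR(s,t)` exists and equals `v`: the
Riemann-Stieltjes sums converge to `v` as both meshes tend to zero, whatever the tags. -/
def HasRSIntegral (f R : Time → Time → ℝ) (v : ℝ) : Prop :=
  ∀ ε > 0, ∃ δ > 0, ∀ D D' : Partition, D.MeshLT δ → D'.MeshLT δ →
    ∀ ν μ : ℕ → Time, D.IsTag ν → D'.IsTag μ →
      |(∑ k ∈ Finset.range D.n, ∑ l ∈ Finset.range D'.n,
        f (ν k) (μ l) * cell R D D' k l) - v| < ε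

/-- The iterated Riemann-Stieltjes integral
`∬ (∬ f(s,u) g(t,v) dR(s,t)) dR'(u,v)` exists and equals `w`. -/
def HasQuadIntegral (f g R R' : Time → Time → ℝ) (w : ℝ) : Prop :=
  ∃ F : Time → Time → ℝ,
    (∀ u v, HasRSIntegral (fun s t => f s u * g t v) R (F u v)) ∧ HasRSIntegral F R' w

/-! ### Covariance functions and step functions -/

/-- A (symmetric, positive semidefinite) covariance function on `[0,1]`. -/
structure CovFun where
  toFun : Time → Time → ℝ
  symm : ∀ s t, toFun s t = toFun t s
  nonneg : ∀ c : Time →₀ ℝ, 0 ≤ c.sum fun s a => c.sum fun t b => a * b * toFun s t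

/-- The covariance function of a square integrable process. -/
def covFun {Ω : Type*} [MeasurableSpace Ω] (P : Measure Ω) [IsProbabilityMeasure P]
    (X : Time → Ω → ℝ) (hX : ∀ t, MemLp (X t) 2 P) : CovFun where
  toFun s t := cov[X s, X t; P]
  symm s t := covariance_comm _ _
  nonneg c := by
    have h : (c.sum fun s a => c.sum fun t b => a * b * cov[X s, X t; P]) =
        cov[fun ω => ∑ s ∈ c.support, c s * X s ω, fun ω => ∑ s ∈ c.support, c s * X s ω; P] := by
      rw [covariance_fun_sum_fun_sum' (fun s _ => (hX s).const_mul (c s))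
        (fun s _ => (hX s).const_mul (c s))]
      simp only [Finsupp.sum, covariance_const_mul_left, covariance_const_mul_right]
      refine Finset.sum_congr rfl fun s _ => Finset.sum_congr rfl fun t _ => by ring
    rw [h]
    exact integral_nonneg fun ω => mul_self_nonneg _

/-- Step functions on `[0,1]`, written in the generators `𝟙_{(0,t]}`: the finitely supported
family `c` stands for the step function `∑ₜ c(t) 𝟙_{(0,t]}`; thus `𝟙_{(s,t]}` is
`single t 1 - single s 1`. The generator with `t = 0` is the zero function. -/
abbrev Step : Type := Time →₀ ℝ

/-- The value of a step function at a point of `[0,1]`. -/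
def Step.eval (φ : Step) (x : Time) : ℝ :=
  φ.sum fun t a => if 0 < x ∧ x ≤ t then a else 0

/-- The integral `∬ φ(s) ψ(t) dR(s,t)` of step functions, determined by bilinearity and
`∬_{(0,u] × (0,v]} dR = R(u,v)`. -/
def CovFun.form (R : CovFun) (φ ψ : Step) : ℝ :=
  φ.sum fun s a => ψ.sum fun t b => a * b * R.toFun s t

lemma CovFun.form_symm (R : CovFun) (φ ψ : Step) : R.form φ ψ = R.form ψ φ := by
  unfold CovFun.form
  rw [Finsupp.sum_comm]
  refine Finset.sum_congr rfl fun t _ => Finset.sum_congr rfl fun s _ => ?_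
  simp only [R.symm s t]
  ring

lemma CovFun.form_add_left (R : CovFun) (φ φ' ψ : Step) :
    R.form (φ + φ') ψ = R.form φ ψ + R.form φ' ψ := by
  unfold CovFun.form
  rw [Finsupp.sum_add_index']
  · intro s; simp
  · intro s a b
    rw [← Finsupp.sum_add]
    exact Finset.sum_congr rfl fun t _ => by ring

lemma CovFun.form_smul_left (R : CovFun) (r : ℝ) (φ ψ : Step) :
    R.form (r • φ) ψ = r * R.form φ ψ := by
  unfold CovFun.form
  rw [Finsupp.sum_smul_index' (by intro s; simp), Finsupp.mul_sum]
  refine Finset.sum_congr rfl fun s _ => ?_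
  beta_reduce
  rw [Finsupp.mul_sum]
  exact Finset.sum_congr rfl fun t _ => by simp only [smul_eq_mul]; ring

/-- Step functions on `[0,1] × {1,2}`: pairs `f(t,i) = δ_{1i} φ₁(t) + δ_{2i} φ₂(t)`. The covariance
functions `R` are recorded in the type, because they determine the inner product. -/
def Step₂ (_R : Fin 2 → CovFun) : Type := Fin 2 → Step

namespace Step₂

variable (R : Fin 2 → CovFun)

/-- The step function on `[0,1] × {1,2}` with given components. -/
def mk (φ : Fin 2 → Step) : Step₂ R := φ

/-- The component `f(·,i)`. -/
def comp {R : Fin 2 → CovFun} (f : Step₂ R) (i : Fin 2) : Step := f i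

instance : AddCommGroup (Step₂ R) := inferInstanceAs (AddCommGroup (Fin 2 → Time →₀ ℝ))

instance : Module ℝ (Step₂ R) := inferInstanceAs (Module ℝ (Fin 2 → Time →₀ ℝ))

/-- `⟨f,g⟩ = ∑ᵢ ∬ f(s,i) g(t,i) dRᵢ(s,t)`. -/
instance core : PreInnerProductSpace.Core ℝ (Step₂ R) where
  inner f g := ∑ i, (R i).form (f.comp i) (g.comp i)
  conj_inner_symm f g := by
    simp only [conj_trivial]
    exact Finset.sum_congr rfl fun i _ => (R i).form_symm _ _
  re_inner_nonneg f := Finset.sum_nonneg fun i _ => (R i).nonneg _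
  add_left f g h := by
    rw [← Finset.sum_add_distrib]
    exact Finset.sum_congr rfl fun i _ => (R i).form_add_left _ _ _
  smul_left f g r := by
    simp only [conj_trivial]
    rw [Finset.mul_sum]
    exact Finset.sum_congr rfl fun i _ => (R i).form_smul_left _ _ _

instance : SeminormedAddCommGroup (Step₂ R) :=
  InnerProductSpace.Core.toSeminormedAddCommGroup (𝕜 := ℝ)

instance : InnerProductSpace ℝ (Step₂ R) := InnerProductSpace.ofCore (core R)

variable {R}

/-- The linear functional `f ↦ f(x,i)`. -/
def evalₗ (x : Time) (i : Fin 2) : Step₂ R →ₗ[ℝ] ℝ where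
  toFun f := (f.comp i).eval x
  map_add' f g := by
    have : ((f + g).comp i) = f.comp i + g.comp i := rfl
    rw [this]
    unfold Step.eval
    rw [Finsupp.sum_add_index'] <;> intros <;> split_ifs <;> simp
  map_smul' r f := by
    have : ((r • f).comp i) = r • f.comp i := rfl
    rw [this]
    unfold Step.eval
    rw [Finsupp.sum_smul_index' (by intro; simp), RingHom.id_apply, smul_eq_mul, Finsupp.mul_sum]
    exact Finset.sum_congr rfl fun t _ => by simp

/-- The value `g((x,i),(y,j))` of an element of the algebraic tensor square of the step functions,
where `φ ⊗ ψ` is the function `φ(x,i) ψ(y,j)`. -/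
def evalTensor (g : Step₂ R ⊗[ℝ] Step₂ R) (i j : Fin 2) (x y : Time) : ℝ :=
  LinearMap.mul' ℝ ℝ (TensorProduct.map (evalₗ x i) (evalₗ y j) g)

end Step₂

/-! ### The Hilbert space `H`, its tensor square, the isonormal process and the double integral -/

/-- The Hilbert space `H`, completion of the step functions on `[0,1] × {1,2}`. -/
abbrev Hil (R : Fin 2 → CovFun) : Type := UniformSpace.Completion (Step₂ R)

/-- The Hilbert tensor square of `H`. -/
abbrev HilTensor (R : Fin 2 → CovFun) : Type := UniformSpace.Completion (Hil R ⊗[ℝ] Hil R)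

variable {R : Fin 2 → CovFun}

/-- The elementary tensor `x ⊗ y` as an element of the Hilbert tensor square of `H`. -/
def tensor (x y : Hil R) : HilTensor R := ((x ⊗ₜ[ℝ] y : Hil R ⊗[ℝ] Hil R) : HilTensor R)

/-- The class, in the Hilbert tensor square of `H`, of a step function of two variables. -/
def ofStep (g : Step₂ R ⊗[ℝ] Step₂ R) : HilTensor R :=
  ((TensorProduct.map (UniformSpace.Completion.toComplₗᵢ (𝕜 := ℝ) (E := Step₂ R)).toLinearMap
    (UniformSpace.Completion.toComplₗᵢ (𝕜 := ℝ) (E := Step₂ R)).toLinearMap g :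
      Hil R ⊗[ℝ] Hil R) : HilTensor R)

variable (R) in
/-- The symmetric (Hilbert) tensor square of `H`. -/
def symTensor : Submodule ℝ (HilTensor R) :=
  (Submodule.span ℝ (Set.range fun z : Hil R × Hil R =>
    tensor z.1 z.2 + tensor z.2 z.1)).topologicalClosure

variable {Ω : Type*} [MeasurableSpace Ω]

/-- `W` is the isonormal Gaussian process on `H` induced by `X = (X₁, X₂)`: a centred Gaussian
family, indexed linearly and isometrically by `H`, with `W(f) = X₁(f(·,1)) + X₂(f(·,2))` for step
functions `f`, where `Xᵢ(𝟙_{(0,t]}) = Xᵢ(t)`. -/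
structure IsIsonormal (P : Measure Ω) (X : Fin 2 → Time → Ω → ℝ)
    (W : Hil R →ₗᵢ[ℝ] Lp ℝ 2 P) : Prop where
  on_step : ∀ f : Step₂ R, W (f : Hil R) =ᵐ[P]
    fun ω => ∑ i, (f.comp i).sum fun t a => a * X i t ω
  gaussian : ∀ h : Hil R, HasLaw (W h) (gaussianReal 0 (‖h‖₊ ^ 2)) P

/-- `I₂` is the double Wiener-Itô integral with respect to `W`: the continuous linear map on the
Hilbert tensor square of `H` with `I₂(x ⊗ y) = W(x) W(y) - ⟨x,y⟩`. -/
def IsDoubleIntegral {P : Measure Ω} (W : Hil R →ₗᵢ[ℝ] Lp ℝ 2 P)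
    (I₂ : HilTensor R →L[ℝ] Lp ℝ 2 P) : Prop :=
  ∀ x y : Hil R, I₂ (tensor x y) =ᵐ[P] fun ω => W x ω * W y ω - ⟪x, y⟫_ℝ

/-! ### The Lévy kernel and the generalised Lévy area -/

/-- The Lévy kernel `f_{ij}(s,t)`; the indices `0`, `1` stand for the two processes. -/
def levyKernel (i j : Fin 2) (s t : Time) : ℝ :=
  if i = 0 ∧ j = 1 then ((if s < t then 1 else 0) - (if t < s then 1 else 0)) / 2
  else if i = 1 ∧ j = 0 then ((if t < s then 1 else 0) - (if s < t then 1 else 0)) / 2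
  else 0

/-- The element `f` of the symmetric tensor square of `H` represents the Lévy kernel: for every step
function `g`, all the iterated integrals
`∬ (∬ levyKernel_{ij}(s,u) g_{ij}(t,v) dRᵢ(s,t)) dRⱼ(u,v)` exist and their sum is `⟨f,g⟩`. -/
def RepresentsLevyKernel (f : HilTensor R) : Prop :=
  f ∈ symTensor R ∧
  ∀ g : Step₂ R ⊗[ℝ] Step₂ R, ∃ w : Fin 2 → Fin 2 → ℝ,
    (∀ i j, HasQuadIntegral (levyKernel i j) (Step₂.evalTensor g i j)
      (R i).toFun (R j).toFun (w i j)) ∧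
    ⟪f, ofStep g⟫_ℝ = ∑ i, ∑ j, w i j

/-- The random variable `A` is a generalised Lévy area of the two processes `X 0`, `X 1`: it is the
double Wiener-Itô integral of an element of the symmetric tensor square of `H` that represents the
Lévy kernel. -/
def IsGeneralisedLevyArea (P : Measure Ω) [IsProbabilityMeasure P] (X : Fin 2 → Time → Ω → ℝ)
    (A : Lp ℝ 2 P) : Prop :=
  ∃ (hX : ∀ i t, MemLp (X i t) 2 P)
    (W : Hil (fun i => covFun P (X i) (hX i)) →ₗᵢ[ℝ] Lp ℝ 2 P)
    (I₂ : HilTensor (fun i => covFun P (X i) (hX i)) →L[ℝ] Lp ℝ 2 P)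
    (f : HilTensor (fun i => covFun P (X i) (hX i))),
      IsIsonormal P X W ∧ IsDoubleIntegral W I₂ ∧ RepresentsLevyKernel f ∧ A = I₂ f

/-- A generalised Lévy area of `X` and `Y` exists. -/
def HasGeneralisedLevyArea (P : Measure Ω) [IsProbabilityMeasure P] (X Y : Time → Ω → ℝ) : Prop :=
  ∃ A : Lp ℝ 2 P, IsGeneralisedLevyArea P ![X, Y] A

/-! ### Fractional Brownian motion -/

/-- `X` is a fractional Brownian motion on `[0,1]` with Hurst parameter `H`. -/
structure IsFractionalBrownianMotion (H : ℝ) (P : Measure Ω) (X : Time → Ω → ℝ) : Prop where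
  gaussian : IsGaussianProcess X P
  centered : ∀ t, ∫ ω, X t ω ∂P = 0
  cov : ∀ s t : Time, cov[X s, X t; P] =
    ((s : ℝ) ^ (2 * H) + (t : ℝ) ^ (2 * H) - |(s : ℝ) - t| ^ (2 * H)) / 2
  continuous_paths : ∀ᵐ ω ∂P, Continuous fun t => X t ω

end

end LevyArea

namespace LevyArea

open Filter Topology

noncomputable section

/-! ### Gaussian isometries and the double integral -/

/-! Write `a = 2H`, `a' = 2H'`. Every assertion reduces to existence for `a + a' > 1`. Indeed a
variation exponent `p` of the first covariance satisfies `1/p ≤ a`: the `n` diagonal squares of the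
uniform partition with `n` intervals each carry an increment `n^(-a)`, so they contribute `n^(1 - a
p)` (`one_le_mul_of_hasFinitePVariation`). Hence `1/p + 1/q > 1` already forces `a + a' > 1`.
Conversely `max 1 (1/a)` is a variation exponent, because the increments over a strip of height `h`
have total variation at most `2 h^(min 1 a)` (`sum_abs_rect_fbmCov_le`).

The Lévy kernel is reached as a weak limit. Off the diagonal `f₁₂(s,t)` equals `𝟙_{s<t} - 1/2`, so
along the uniform partition it is approximated by `∑ₖ (𝟙_{(0,uₖ]} - ½ 𝟙_{(0,1]}) ⊗ 𝟙_{(uₖ,uₖ₊₁]}`,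
symmetrised to account for `f₂₁(s,t) = f₁₂(t,s)`. The squared norm of the main part is `∑ R₁(uₖ,uₗ)
□R₂(k,l)`. For fractional Brownian motion this is bounded by hand: its singular part is at most
`n^(-a-a') ∑_{k≠l} |k-l|^(a+a'-2)`, where the condition `a + a' > 1` makes the sum of order
`n^(a+a')` (`exists_sum_fbmCov_mul_cell_le`). Weak compactness then gives a limit point in the
closed subspace of symmetric tensors.

To identify its pairings, bilinearity reduces to products of generators. There the inner integral is
explicit, `R₁(u,τ) - R₁(1,τ)/2`, and the outer one becomes a one-dimensional integral against
`R₂(·,σ)`. It exists classically, since this section is a difference of continuous monotone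
functions, and its Riemann sums are exactly the pairings with the approximations.

The probabilistic side is the extension of two bounded maps to completions. The map from step
functions to random variables is an isometry by independence, and Gaussian laws survive `L²` limits.
The map `x ⊗ y ↦ W(x)W(y) - ⟨x,y⟩` is bounded on the algebraic tensor square by Wick's formula, a
polarisation of the fourth moment of a Gaussian. -/

/-- The fourth moment of a centred Gaussian. -/
lemma integral_pow_four_gaussianReal (v : NNReal) :
    ∫ x, x ^ 4 ∂(gaussianReal 0 v) = 3 * (v : ℝ) ^ 2 := by
  have h := iteratedDeriv_mgf_zero (X := id) (μ := gaussianReal 0 v) (by simp) 4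
  simp only [Pi.pow_apply, id] at h
  rw [← h, mgf_id_gaussianReal]
  -- Each derivative of the moment generating function is a polynomial times the same exponential,
  -- so the fourth derivative comes from applying one rule to the polynomial factor four times.
  have key : ∀ (p q : ℝ → ℝ), (∀ t, HasDerivAt p (q t) t) →
      deriv (fun t => p t * Real.exp (0 * t + v * t ^ 2 / 2)) =
        fun t => (q t + p t * (v * t)) * Real.exp (0 * t + v * t ^ 2 / 2) := by
    intro p q hp
    funext t
    have h1 : HasDerivAt (fun t : ℝ => 0 * t + v * t ^ 2 / 2) (v * t) t := by
      have := (((hasDerivAt_id t).const_mul (0 : ℝ)).add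
        ((((hasDerivAt_id t).pow 2).const_mul (v : ℝ)).div_const 2))
      convert! this using 1
      simp; ring
    have := ((hp t).mul h1.exp).deriv
    rw [show (fun t => p t * Real.exp (0 * t + v * t ^ 2 / 2)) =
      (p * fun t => Real.exp (0 * t + v * t ^ 2 / 2)) from rfl, this]
    ring
  have e0 : (fun t : ℝ => Real.exp (0 * t + v * t ^ 2 / 2)) =
      fun t => (1 : ℝ) * Real.exp (0 * t + v * t ^ 2 / 2) := by simp
  rw [iteratedDeriv_succ', iteratedDeriv_succ', iteratedDeriv_succ', iteratedDeriv_succ',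
    iteratedDeriv_zero, e0, key (fun _ => 1) (fun _ => 0) (fun t => hasDerivAt_const t 1),
    key _ (fun _ => (v : ℝ)) (fun t => by
      simpa using (hasDerivAt_id t).const_mul (v : ℝ)),
    key _ (fun t => 2 * (v : ℝ) ^ 2 * t) (fun t => by
      have := (hasDerivAt_const t (v : ℝ)).add (((hasDerivAt_id t).pow 2).const_mul ((v : ℝ) ^ 2))
      convert! this using 1
      · funext s; simp; ring
      · simp; ring),
    key _ (fun t => 3 * (v : ℝ) ^ 2 + 3 * (v : ℝ) ^ 3 * t ^ 2) (fun t => by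
      have := ((hasDerivAt_id t).const_mul (3 * (v : ℝ) ^ 2)).add
        (((hasDerivAt_id t).pow 3).const_mul ((v : ℝ) ^ 3))
      convert! this using 1
      · funext s; simp; ring
      · simp; ring)]
  simp

section GaussianIsometry

variable {Ω : Type*} [MeasurableSpace Ω] {P : Measure Ω} [IsProbabilityMeasure P]
  {U : Type*} [NormedAddCommGroup U] [InnerProductSpace ℝ U]

/-- Every value of the linear isometry `W` is a centred Gaussian variable. -/
def IsGaussianIsometry (W : U →ₗᵢ[ℝ] Lp ℝ 2 P) : Prop :=
  ∀ h : U, HasLaw (W h) (gaussianReal 0 (‖h‖₊ ^ 2)) P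

variable {W : U →ₗᵢ[ℝ] Lp ℝ 2 P}

omit [IsProbabilityMeasure P] in
lemma IsGaussianIsometry.memLp (hW : IsGaussianIsometry W) (h : U) {p : ℝ≥0∞} (hp : p ≠ ∞) :
    MemLp (W h) p P :=
  (hW h).hasGaussianLaw.memLp hp

omit [IsProbabilityMeasure P] in
lemma IsGaussianIsometry.integral_pow_four (hW : IsGaussianIsometry W) (h : U) :
    ∫ ω, (W h ω) ^ 4 ∂P = 3 * ‖h‖ ^ 4 := by
  have := (hW h).integral_comp (f := fun x : ℝ => x ^ 4) (by fun_prop)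
  simp only [Function.comp_def] at this
  rw [this, integral_pow_four_gaussianReal]
  simp; ring

omit [IsProbabilityMeasure P] in
lemma IsGaussianIsometry.memLp_mul (hW : IsGaussianIsometry W) (x y : U) :
    MemLp (fun ω => W x ω * W y ω) 2 P := by
  have : ENNReal.HolderTriple 4 4 2 := ⟨by
    rw [← ENNReal.toReal_eq_toReal_iff' (by simp) (by simp), ENNReal.toReal_add (by simp) (by simp)]
    simp; norm_num⟩
  exact MemLp.mul' (p := 4) (q := 4) (hW.memLp y (by simp)) (hW.memLp x (by simp))

omit [IsProbabilityMeasure P] in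
lemma IsGaussianIsometry.integrable_mul_mul (hW : IsGaussianIsometry W) (x y z w : U) :
    Integrable (fun ω => W x ω * W y ω * (W z ω * W w ω)) P :=
  (hW.memLp_mul x y).integrable_mul (hW.memLp_mul z w)

omit [IsProbabilityMeasure P] in
lemma IsGaussianIsometry.integrable_pow_four (hW : IsGaussianIsometry W) (x : U) :
    Integrable (fun ω => W x ω ^ 4) P := by
  refine (hW.integrable_mul_mul x x x x).congr (ae_of_all _ fun ω => ?_)
  ring

omit [IsProbabilityMeasure P] in
/-- The Wick formula for four Gaussian variables. -/
lemma IsGaussianIsometry.wick (hW : IsGaussianIsometry W) (x y z w : U) :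
    ∫ ω, W x ω * W y ω * (W z ω * W w ω) ∂P =
      ⟪x, y⟫_ℝ * ⟪z, w⟫_ℝ + ⟪x, z⟫_ℝ * ⟪y, w⟫_ℝ + ⟪x, w⟫_ℝ * ⟪y, z⟫_ℝ := by
  have comb : ∀ b c d : ℝ, (W (x + b • y + c • z + d • w) : Ω → ℝ) =ᵐ[P]
      fun ω => W x ω + b * W y ω + c * W z ω + d * W w ω := by
    intro b c d
    simp only [map_add, map_smul]
    filter_upwards [Lp.coeFn_add (W x + b • W y + c • W z) (d • W w),
      Lp.coeFn_add (W x + b • W y) (c • W z), Lp.coeFn_add (W x) (b • W y),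
      Lp.coeFn_smul b (W y), Lp.coeFn_smul c (W z), Lp.coeFn_smul d (W w)] with ω h1 h2 h3 h4 h5 h6
    rw [h1, Pi.add_apply, h2, Pi.add_apply, h3, Pi.add_apply, h4, h5, h6]
    simp
  have norm4 : ∀ b c d : ℝ, ‖x + b • y + c • z + d • w‖ ^ 4 =
      (⟪x, x⟫_ℝ + b ^ 2 * ⟪y, y⟫_ℝ + c ^ 2 * ⟪z, z⟫_ℝ + d ^ 2 * ⟪w, w⟫_ℝ + 2 * (b * ⟪x, y⟫_ℝ
        + c * ⟪x, z⟫_ℝ + d * ⟪x, w⟫_ℝ + b * c * ⟪y, z⟫_ℝ + b * d * ⟪y, w⟫_ℝ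
        + c * d * ⟪z, w⟫_ℝ)) ^ 2 := by
    intro b c d
    rw [show (4 : ℕ) = 2 * 2 from rfl, pow_mul, ← real_inner_self_eq_norm_sq]
    simp only [inner_add_left, inner_add_right, inner_smul_left, inner_smul_right, conj_trivial,
      real_inner_comm x y, real_inner_comm x z, real_inner_comm x w, real_inner_comm y z,
      real_inner_comm y w, real_inner_comm z w]
    ring
  have e : ∀ b c d : ℝ, ∫ ω, W (x + b • y + c • z + d • w) ω ^ 4 ∂P = _ :=
    fun b c d => (hW.integral_pow_four _).trans (congrArg (3 * ·) (norm4 b c d))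
  have hI : ∀ b c d : ℝ, Integrable (fun ω => W (x + b • y + c • z + d • w) ω ^ 4) P :=
    fun b c d => hW.integrable_pow_four _
  -- Polarisation of the fourth power: the sum over signs of `bcd (x + by + cz + dw)^4` retains only
  -- the monomial `xyzw`, with coefficient `2^3 · 4! = 192`.
  have main : ∫ ω, 192 * (W x ω * W y ω * (W z ω * W w ω)) ∂P =
      ∫ ω, (W (x + (1:ℝ) • y + (1:ℝ) • z + (1:ℝ) • w) ω ^ 4
        - W (x + (1:ℝ) • y + (1:ℝ) • z + (-1:ℝ) • w) ω ^ 4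
        - W (x + (1:ℝ) • y + (-1:ℝ) • z + (1:ℝ) • w) ω ^ 4
        + W (x + (1:ℝ) • y + (-1:ℝ) • z + (-1:ℝ) • w) ω ^ 4
        - W (x + (-1:ℝ) • y + (1:ℝ) • z + (1:ℝ) • w) ω ^ 4
        + W (x + (-1:ℝ) • y + (1:ℝ) • z + (-1:ℝ) • w) ω ^ 4
        + W (x + (-1:ℝ) • y + (-1:ℝ) • z + (1:ℝ) • w) ω ^ 4
        - W (x + (-1:ℝ) • y + (-1:ℝ) • z + (-1:ℝ) • w) ω ^ 4) ∂P := by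
    refine integral_congr_ae ?_
    filter_upwards [comb 1 1 1, comb 1 1 (-1), comb 1 (-1) 1, comb 1 (-1) (-1), comb (-1) 1 1,
      comb (-1) 1 (-1), comb (-1) (-1) 1, comb (-1) (-1) (-1)] with ω h1 h2 h3 h4 h5 h6 h7 h8
    rw [h1, h2, h3, h4, h5, h6, h7, h8]
    ring
  rw [integral_const_mul] at main
  rw [integral_sub (by fun_prop) (by fun_prop), integral_add (by fun_prop) (by fun_prop),
    integral_add (by fun_prop) (by fun_prop), integral_sub (by fun_prop) (by fun_prop),
    integral_add (by fun_prop) (by fun_prop), integral_sub (by fun_prop) (by fun_prop),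
    integral_sub (by fun_prop) (by fun_prop), e, e, e, e, e, e, e, e] at main
  linear_combination main / 192

omit [IsProbabilityMeasure P] in
lemma IsGaussianIsometry.integral_mul (x y : U) :
    ∫ ω, W x ω * W y ω ∂P = ⟪x, y⟫_ℝ := by
  rw [← W.inner_map_map x y, L2.inner_def]
  refine integral_congr_ae (ae_of_all _ fun ω => ?_)
  simp [mul_comm]

/-- The second Wick power `W(x) W(y) - ⟨x,y⟩`. -/
def wickMul (hW : IsGaussianIsometry W) (x y : U) : Lp ℝ 2 P :=
  ((hW.memLp_mul x y).sub (memLp_const ⟪x, y⟫_ℝ)).toLp (fun ω => W x ω * W y ω - ⟪x, y⟫_ℝ)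

lemma coeFn_wickMul (hW : IsGaussianIsometry W) (x y : U) :
    wickMul hW x y =ᵐ[P] fun ω => W x ω * W y ω - ⟪x, y⟫_ℝ :=
  MemLp.coeFn_toLp _

lemma wickMul_comm (hW : IsGaussianIsometry W) (x y : U) : wickMul hW x y = wickMul hW y x := by
  refine Lp.ext ?_
  filter_upwards [coeFn_wickMul hW x y, coeFn_wickMul hW y x] with ω h1 h2
  rw [h1, h2, real_inner_comm, mul_comm]

lemma wickMul_add (hW : IsGaussianIsometry W) (x x' y : U) :
    wickMul hW (x + x') y = wickMul hW x y + wickMul hW x' y := by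
  refine Lp.ext ?_
  have h0 : (W (x + x') : Ω → ℝ) =ᵐ[P] W x + W x' := by
    rw [map_add]; exact Lp.coeFn_add _ _
  filter_upwards [coeFn_wickMul hW (x + x') y, coeFn_wickMul hW x y, coeFn_wickMul hW x' y, h0,
    Lp.coeFn_add (wickMul hW x y) (wickMul hW x' y)] with ω h1 h2 h3 h4 h5
  rw [h1, h5, Pi.add_apply, h2, h3, h4, Pi.add_apply, inner_add_left]
  ring

lemma wickMul_smul (hW : IsGaussianIsometry W) (c : ℝ) (x y : U) :
    wickMul hW (c • x) y = c • wickMul hW x y := by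
  refine Lp.ext ?_
  have h0 : (W (c • x) : Ω → ℝ) =ᵐ[P] c • W x := by
    rw [map_smul]; exact Lp.coeFn_smul _ _
  filter_upwards [coeFn_wickMul hW (c • x) y, coeFn_wickMul hW x y, h0,
    Lp.coeFn_smul c (wickMul hW x y)] with ω h1 h2 h3 h4
  rw [h1, h4, Pi.smul_apply, h2, h3, Pi.smul_apply, real_inner_smul_left]
  simp only [smul_eq_mul]
  ring

/-- Subtracting `⟨x,y⟩` and `⟨z,w⟩` removes from Wick's formula the pairing inside the two factors;
the two crossed pairings remain. -/
lemma inner_wickMul (hW : IsGaussianIsometry W) (x y z w : U) :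
    ⟪wickMul hW x y, wickMul hW z w⟫_ℝ =
      ⟪x, z⟫_ℝ * ⟪y, w⟫_ℝ + ⟪x, w⟫_ℝ * ⟪y, z⟫_ℝ := by
  rw [L2.inner_def]
  have h : ∫ ω, ⟪wickMul hW x y ω, wickMul hW z w ω⟫_ℝ ∂P =
      ∫ ω, (W x ω * W y ω * (W z ω * W w ω) - ⟪z, w⟫_ℝ * (W x ω * W y ω)
        - ⟪x, y⟫_ℝ * (W z ω * W w ω) + ⟪x, y⟫_ℝ * ⟪z, w⟫_ℝ) ∂P := by
    refine integral_congr_ae ?_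
    filter_upwards [coeFn_wickMul hW x y, coeFn_wickMul hW z w] with ω h1 h2
    rw [h1, h2]
    simp only [RCLike.inner_apply, conj_trivial]
    ring
  have i1 := hW.integrable_mul_mul x y z w
  have i2 : Integrable (fun ω => W x ω * W y ω) P := (hW.memLp_mul x y).integrable (by simp)
  have i3 : Integrable (fun ω => W z ω * W w ω) P := (hW.memLp_mul z w).integrable (by simp)
  rw [h, integral_add (by fun_prop) (by fun_prop), integral_sub (by fun_prop) (by fun_prop),
    integral_sub (by fun_prop) (by fun_prop), integral_const_mul, integral_const_mul, hW.wick,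
    IsGaussianIsometry.integral_mul, IsGaussianIsometry.integral_mul]
  simp
  ring

/-- The double integral on the algebraic tensor square. -/
def wickTensor (hW : IsGaussianIsometry W) : U ⊗[ℝ] U →ₗ[ℝ] Lp ℝ 2 P :=
  TensorProduct.lift (LinearMap.mk₂ ℝ (wickMul hW) (wickMul_add hW) (wickMul_smul hW)
    (fun x y y' => by
      rw [wickMul_comm, wickMul_add, wickMul_comm hW y, wickMul_comm hW y'])
    (fun c x y => by rw [wickMul_comm, wickMul_smul, wickMul_comm hW y]))

/-- The second crossed pairing is the first one with the factors of `b` exchanged. In this form the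
identity is bilinear and makes sense for all tensors. -/
lemma inner_wickTensor (hW : IsGaussianIsometry W) (a b : U ⊗[ℝ] U) :
    ⟪wickTensor hW a, wickTensor hW b⟫_ℝ = ⟪a, b⟫_ℝ + ⟪a, TensorProduct.comm ℝ U U b⟫_ℝ := by
  induction a with
  | zero => simp
  | add a a' h h' => simp only [map_add, inner_add_left, h, h']; ring
  | tmul x y =>
    induction b with
    | zero => simp
    | add b b' h h' => simp only [map_add, inner_add_right, h, h']; ring
    | tmul z w => simp [wickTensor, inner_wickMul]

/-- The exchange of factors is an isometry, so Cauchy–Schwarz bounds the squared norm by `2‖a‖²`.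
Any constant is enough for extending to the completion. -/
lemma norm_wickTensor_le (hW : IsGaussianIsometry W) (a : U ⊗[ℝ] U) :
    ‖wickTensor hW a‖ ≤ 2 * ‖a‖ := by
  have h := inner_wickTensor hW a a
  have h2 : ‖TensorProduct.comm ℝ U U a‖ = ‖a‖ := (TensorProduct.commIsometry ℝ U U).norm_map a
  have h3 := real_inner_le_norm a (TensorProduct.comm ℝ U U a)
  rw [h2] at h3
  rw [real_inner_self_eq_norm_sq, real_inner_self_eq_norm_sq a] at h
  refine abs_le_of_sq_le_sq' ?_ (by positivity) |>.2
  nlinarith [norm_nonneg a]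

end GaussianIsometry

variable {Ω : Type*} [MeasurableSpace Ω] {P : Measure Ω} [IsProbabilityMeasure P]

/-- The double Wiener-Itô integral of a Gaussian isometry exists. -/
theorem exists_isDoubleIntegral {R : Fin 2 → CovFun} {W : Hil R →ₗᵢ[ℝ] Lp ℝ 2 P}
    (hW : IsGaussianIsometry W) : ∃ I₂ : HilTensor R →L[ℝ] Lp ℝ 2 P, IsDoubleIntegral W I₂ := by
  have hd : DenseRange (UniformSpace.Completion.toComplₗᵢ (𝕜 := ℝ)
      (E := Hil R ⊗[ℝ] Hil R)).toLinearMap := UniformSpace.Completion.denseRange_coe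
  refine ⟨(wickTensor hW).extendOfNorm (UniformSpace.Completion.toComplₗᵢ (𝕜 := ℝ)
      (E := Hil R ⊗[ℝ] Hil R)).toLinearMap, fun x y => ?_⟩
  have := LinearMap.extendOfNorm_eq (f := wickTensor hW) hd
    ⟨2, fun a => by simpa using norm_wickTensor_le hW a⟩ (x ⊗ₜ[ℝ] y)
  have h2 : wickTensor hW (x ⊗ₜ[ℝ] y) = wickMul hW x y := by simp [wickTensor]
  rw [h2] at this
  refine Filter.EventuallyEq.trans ?_ (coeFn_wickMul hW x y)
  rw [← this]
  rfl

/-! ### The isonormal process -/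

section Isonormal

variable {Ω : Type*} [MeasurableSpace Ω] {P : Measure Ω} [IsProbabilityMeasure P]

lemma norm_exp_mul_I_sub_exp_mul_I_le (a b : ℝ) :
    ‖Complex.exp (a * Complex.I) - Complex.exp (b * Complex.I)‖ ≤ |a - b| := by
  have h : Complex.exp (a * Complex.I) - Complex.exp (b * Complex.I) =
      Complex.exp (b * Complex.I) * (Complex.exp (Complex.I * ((a - b : ℝ) : ℂ)) - 1) := by
    rw [mul_sub, ← Complex.exp_add, mul_one]
    push_cast
    ring_nf
  rw [h, norm_mul, Complex.norm_exp_ofReal_mul_I, one_mul]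
  exact Real.norm_exp_I_mul_ofReal_sub_one_le

lemma integral_abs_le_norm (f : Lp ℝ 2 P) : ∫ ω, |f ω| ∂P ≤ ‖f‖ := by
  have h1 : ∫ ω, |f ω| ∂P = (eLpNorm f 1 P).toReal := by
    rw [eLpNorm_one_eq_lintegral_enorm, ← integral_norm_eq_lintegral_enorm
      (Lp.aestronglyMeasurable f)]
    rfl
  rw [h1, Lp.norm_def]
  exact ENNReal.toReal_mono (Lp.eLpNorm_ne_top f)
    (eLpNorm_le_eLpNorm_of_exponent_le (by norm_num) (Lp.aestronglyMeasurable f))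

/-- The characteristic function of the law depends continuously on the variable in `L²`. -/
lemma continuous_integral_cexp (t : ℝ) :
    Continuous fun f : Lp ℝ 2 P => ∫ ω, Complex.exp (t * f ω * Complex.I) ∂P := by
  have hm : ∀ f : Lp ℝ 2 P, Integrable (fun ω => Complex.exp (t * f ω * Complex.I)) P := by
    intro f
    have hf : AEStronglyMeasurable f P := Lp.aestronglyMeasurable f
    refine Integrable.of_bound (C := 1) (by fun_prop) (ae_of_all _ fun ω => ?_)
    rw [← Complex.ofReal_mul, Complex.norm_exp_ofReal_mul_I]
  refine LipschitzWith.continuous (K := ‖t‖₊) (LipschitzWith.of_dist_le_mul fun f g => ?_)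
  rw [dist_eq_norm, dist_eq_norm, ← integral_sub (hm f) (hm g)]
  have hfg : Integrable (fun ω => |(f - g : Lp ℝ 2 P) ω|) P :=
    ((Lp.memLp (f - g)).integrable (by simp)).abs
  calc _ ≤ ∫ ω, ‖Complex.exp (t * f ω * Complex.I) - Complex.exp (t * g ω * Complex.I)‖ ∂P :=
        norm_integral_le_integral_norm _
    _ ≤ ∫ ω, |t| * |(f - g : Lp ℝ 2 P) ω| ∂P := by
        refine integral_mono_ae ((hm f).sub (hm g)).norm (hfg.const_mul _) ?_
        filter_upwards [Lp.coeFn_sub f g] with ω h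
        rw [h, Pi.sub_apply, ← abs_mul, mul_sub]
        have := norm_exp_mul_I_sub_exp_mul_I_le (t * f ω) (t * g ω)
        push_cast at this
        exact this
    _ ≤ |t| * ‖f - g‖ := by
        rw [integral_const_mul]
        exact mul_le_mul_of_nonneg_left (integral_abs_le_norm _) (abs_nonneg _)
    _ = _ := rfl

/-- A linear isometry that is Gaussian on a dense set is Gaussian. -/
lemma isGaussianIsometry_of_dense {U : Type*} [NormedAddCommGroup U] [InnerProductSpace ℝ U]
    {W : U →ₗᵢ[ℝ] Lp ℝ 2 P} {ι : Type*} {e : ι → U} (he : DenseRange e)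
    (h : ∀ i, HasLaw (W (e i)) (gaussianReal 0 (‖e i‖₊ ^ 2)) P) : IsGaussianIsometry W := by
  have hae : ∀ x, AEMeasurable (W x) P := fun x => (Lp.aestronglyMeasurable (W x)).aemeasurable
  have hc : ∀ x t, charFun (P.map (W x)) t = ∫ ω, Complex.exp (t * W x ω * Complex.I) ∂P := by
    intro x t
    rw [charFun_apply_real, integral_map (hae x) (by fun_prop)]
  -- For fixed `t` both sides are continuous in `x`, so equality on the dense family propagates.
  have key : ∀ t : ℝ, ∀ x, ∫ ω, Complex.exp (t * W x ω * Complex.I) ∂P =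
      Complex.exp (t * (0 : ℝ) * Complex.I - ((‖x‖₊ ^ 2 : NNReal) : ℝ) * t ^ 2 / 2) := by
    intro t
    refine isClosed_property he (isClosed_eq ((continuous_integral_cexp t).comp W.continuous)
      (by fun_prop)) fun i => ?_
    have := hc (e i) t
    rw [← this, (h i).map_eq, charFun_gaussianReal]
  intro x
  refine ⟨hae x, ?_⟩
  have : IsProbabilityMeasure (P.map (W x)) := Measure.isProbabilityMeasure_map (hae x)
  refine Measure.ext_of_charFun (funext fun t => ?_)
  rw [hc, key, charFun_gaussianReal]

/-- The random variable associated with a step function of one time variable. -/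
def stepSum (X : Time → Ω → ℝ) (φ : Step) (ω : Ω) : ℝ := φ.sum fun t a => a * X t ω

omit [MeasurableSpace Ω] in
lemma stepSum_add (X : Time → Ω → ℝ) (φ ψ : Step) (ω : Ω) :
    stepSum X (φ + ψ) ω = stepSum X φ ω + stepSum X ψ ω :=
  Finsupp.sum_add_index' (by simp) (by intros; ring)

omit [MeasurableSpace Ω] in
lemma stepSum_smul (X : Time → Ω → ℝ) (r : ℝ) (φ : Step) (ω : Ω) :
    stepSum X (r • φ) ω = r * stepSum X φ ω := by
  unfold stepSum
  rw [Finsupp.sum_smul_index' (by simp), Finsupp.mul_sum]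
  simp [mul_assoc]

lemma variance_stepSum {X : Time → Ω → ℝ} (hX : ∀ t, MemLp (X t) 2 P) (φ : Step) :
    Var[stepSum X φ; P] = (covFun P X hX).form φ φ := by
  have e : stepSum X φ = fun ω => ∑ s ∈ φ.support, φ s * X s ω := rfl
  rw [← covariance_self (by
    rw [e]
    exact (memLp_finsetSum _ fun s _ => (hX s).const_mul (φ s)).aestronglyMeasurable.aemeasurable),
    e, covariance_fun_sum_fun_sum' (fun s _ => (hX s).const_mul (φ s))
        (fun s _ => (hX s).const_mul (φ s))]
  unfold CovFun.form covFun
  simp only [Finsupp.sum, covariance_const_mul_left, covariance_const_mul_right]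
  exact Finset.sum_congr rfl fun s _ => Finset.sum_congr rfl fun t _ => by ring

lemma map_stepSum {X : Time → Ω → ℝ} (hX : ∀ t, MemLp (X t) 2 P) (hG : IsGaussianProcess X P)
    (h0 : ∀ t, ∫ ω, X t ω ∂P = 0) (φ : Step) :
    P.map (stepSum X φ) = gaussianReal 0 ((covFun P X hX).form φ φ).toNNReal := by
  have hg : HasGaussianLaw (stepSum X φ) P := (hG.smul φ).hasGaussianLaw_fun_sum
  rw [hg.map_eq_gaussianReal, variance_stepSum hX]
  congr 1
  simp only [stepSum, Finsupp.sum]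
  rw [integral_finsetSum _ fun t _ => ((hX t).integrable (by simp)).const_mul _]
  exact Finset.sum_eq_zero fun t _ => by rw [integral_const_mul, h0, mul_zero]

variable {X : Fin 2 → Time → Ω → ℝ} (hX : ∀ i t, MemLp (X i t) 2 P)

omit [IsProbabilityMeasure P] in
include hX in
lemma memLp_stepSum₂ (f : Fin 2 → Step) : MemLp (fun ω => ∑ i, stepSum (X i) (f i) ω) 2 P :=
  memLp_finsetSum _ fun i _ => memLp_finsetSum _ fun t _ => (hX i t).const_mul _

/-- The isonormal process on step functions, as a linear map. -/
def isonormalStep : Step₂ (fun i => covFun P (X i) (hX i)) →ₗ[ℝ] Lp ℝ 2 P where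
  toFun f := (memLp_stepSum₂ hX f).toLp _
  map_add' f g := by
    rw [← MemLp.toLp_add]
    congr 1
    funext ω
    rw [Pi.add_apply, ← Finset.sum_add_distrib]
    exact Finset.sum_congr rfl fun i _ => stepSum_add _ _ _ _
  map_smul' r f := by
    rw [RingHom.id_apply, ← MemLp.toLp_const_smul]
    congr 1
    funext ω
    rw [Pi.smul_apply, smul_eq_mul, Finset.mul_sum]
    exact Finset.sum_congr rfl fun i _ => stepSum_smul _ _ _ _

lemma coeFn_isonormalStep (f : Step₂ (fun i => covFun P (X i) (hX i))) :
    isonormalStep hX f =ᵐ[P] fun ω => ∑ i, (f.comp i).sum fun t a => a * X i t ω :=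
  MemLp.coeFn_toLp (memLp_stepSum₂ hX f)

lemma Step₂.norm_sq {R : Fin 2 → CovFun} (f : Step₂ R) :
    ‖f‖ ^ 2 = ∑ i, (R i).form (f.comp i) (f.comp i) :=
  (real_inner_self_eq_norm_sq f).symm

lemma CovFun.form_self_nonneg (R : CovFun) (φ : Step) : 0 ≤ R.form φ φ := R.nonneg φ

variable (hG : ∀ i, IsGaussianProcess (X i) P) (h0 : ∀ i t, ∫ ω, X i t ω ∂P = 0)
  (hI : IndepFun (fun ω t => X 0 t ω) (fun ω t => X 1 t ω) P)

include hG h0 hI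

/-- Independence makes the sum Gaussian and adds the variances, which is how the inner product on
pairs of step functions adds its two components. -/
lemma hasLaw_isonormalStep (f : Step₂ (fun i => covFun P (X i) (hX i))) :
    HasLaw (isonormalStep hX f) (gaussianReal 0 (‖f‖₊ ^ 2)) P := by
  have hm : ∀ φ : Step, Measurable fun x : Time → ℝ => φ.sum fun t a => a * x t := by
    intro φ
    unfold Finsupp.sum
    fun_prop
  have hind : IndepFun (stepSum (X 0) (f.comp 0)) (stepSum (X 1) (f.comp 1)) P :=
    hI.comp (hm (f.comp 0)) (hm (f.comp 1))
  have hs := gaussianReal_add_gaussianReal_of_indepFun hind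
    (map_stepSum (hX 0) (hG 0) (h0 0) (f.comp 0)) (map_stepSum (hX 1) (hG 1) (h0 1) (f.comp 1))
  refine HasLaw.congr (X := stepSum (X 0) (f.comp 0) + stepSum (X 1) (f.comp 1)) ⟨?_, ?_⟩ ?_
  · exact AEMeasurable.of_map_ne_zero (by rw [hs]; exact IsProbabilityMeasure.ne_zero _)
  · rw [hs, add_zero]
    congr 1
    apply NNReal.coe_injective
    push_cast
    rw [Real.coe_toNNReal _ (CovFun.form_self_nonneg _ _),
      Real.coe_toNNReal _ (CovFun.form_self_nonneg _ _), Step₂.norm_sq,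
      Fin.sum_univ_two]
  · filter_upwards [coeFn_isonormalStep hX f] with ω h
    rw [h, Fin.sum_univ_two]
    rfl

lemma norm_isonormalStep (f : Step₂ (fun i => covFun P (X i) (hX i))) :
    ‖isonormalStep hX f‖ = ‖f‖ := by
  have hl := hasLaw_isonormalStep hX hG h0 hI f
  have h1 : ‖isonormalStep hX f‖ ^ 2 = ‖f‖ ^ 2 := by
    rw [← real_inner_self_eq_norm_sq, L2.inner_def]
    have h2 := hl.integral_comp (f := fun x : ℝ => x ^ 2) (by fun_prop)
    have h3 := variance_eq_integral (μ := gaussianReal 0 (‖f‖₊ ^ 2)) (X := fun x : ℝ => x)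
      (by fun_prop)
    rw [variance_fun_id_gaussianReal, integral_id_gaussianReal] at h3
    simp only [sub_zero] at h3
    rw [← h3] at h2
    simp only [Function.comp_def] at h2
    calc _ = ∫ ω, (isonormalStep hX f ω) ^ 2 ∂P :=
          integral_congr_ae (ae_of_all _ fun ω => by simp [sq])
      _ = _ := by rw [h2]; simp
  exact (pow_left_inj₀ (norm_nonneg _) (norm_nonneg _) two_ne_zero).1 h1

/-- The isonormal process of two independent centred Gaussian processes exists. -/
theorem exists_isIsonormal :
    ∃ W : Hil (fun i => covFun P (X i) (hX i)) →ₗᵢ[ℝ] Lp ℝ 2 P, IsIsonormal P X W := by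
  set e := (UniformSpace.Completion.toComplₗᵢ (𝕜 := ℝ)
    (E := Step₂ (fun i => covFun P (X i) (hX i)))).toLinearMap with he
  have hd : DenseRange e := UniformSpace.Completion.denseRange_coe
  have hn := norm_isonormalStep hX hG h0 hI
  have hb : ∃ C, ∀ f, ‖isonormalStep hX f‖ ≤ C * ‖e f‖ := ⟨1, fun f => by simp [he, hn]⟩
  have hext := LinearMap.extendOfNorm_eq (f := isonormalStep hX) hd hb
  set W₀ := (isonormalStep hX).extendOfNorm e with hW₀
  have hiso : ∀ h, ‖W₀ h‖ = ‖h‖ := by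
    refine isClosed_property hd (isClosed_eq (by fun_prop) (by fun_prop)) fun f => ?_
    rw [hext, hn]
    simp [he]
  refine ⟨⟨W₀.toLinearMap, hiso⟩, fun f => ?_, ?_⟩
  · have h1 : W₀ (f : Hil (fun i => covFun P (X i) (hX i))) = isonormalStep hX f := hext f
    change W₀ (f : Hil (fun i => covFun P (X i) (hX i))) =ᵐ[P] _
    rw [h1]
    exact coeFn_isonormalStep hX f
  · refine isGaussianIsometry_of_dense (W := ⟨W₀.toLinearMap, hiso⟩) hd fun f => ?_
    have h1 : W₀ (e f) = isonormalStep hX f := hext f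
    change HasLaw (W₀ (e f)) _ P
    rw [h1]
    have h2 : ‖e f‖₊ = ‖f‖₊ := by
      apply NNReal.coe_injective
      simp [he]
    rw [h2]
    exact hasLaw_isonormalStep hX hG h0 hI f

end Isonormal

/-! ### The covariance function of fractional Brownian motion -/

/-- The covariance function of fractional Brownian motion with Hurst parameter `a / 2`. -/
def fbmCov (a : ℝ) (s t : Time) : ℝ :=
  ((s : ℝ) ^ a + (t : ℝ) ^ a - |(s : ℝ) - t| ^ a) / 2

/-- The terms depending on one variable only cancel, so all increments are second differences of
`|·|^a`. -/
lemma rect_fbmCov (a : ℝ) (s s' t t' : Time) :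
    rect (fbmCov a) s s' t t' =
      ((|(s' : ℝ) - t| ^ a - |(s' : ℝ) - t'| ^ a) - (|(s : ℝ) - t| ^ a - |(s : ℝ) - t'| ^ a)) / 2 := by
  unfold rect fbmCov
  ring

lemma fbmCov_symm (a : ℝ) (s t : Time) : fbmCov a s t = fbmCov a t s := by
  unfold fbmCov
  rw [abs_sub_comm]
  ring

lemma fbmCov_zero_left {a : ℝ} (ha : 0 < a) (t : Time) : fbmCov a 0 t = 0 := by
  simp [fbmCov, Real.zero_rpow ha.ne', abs_of_nonneg t.2.1]

lemma fbmCov_zero_right {a : ℝ} (ha : 0 < a) (t : Time) : fbmCov a t 0 = 0 := by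
  rw [fbmCov_symm, fbmCov_zero_left ha]

lemma rect_swap (f : Time → Time → ℝ) (s s' t t' : Time) : rect f s s' t' t = -rect f s s' t t' := by
  unfold rect
  ring

lemma rect_flip {f : Time → Time → ℝ} (hf : ∀ s t, f s t = f t s) (s s' t t' : Time) :
    rect f s s' t t' = rect f t t' s s' := by
  unfold rect
  rw [hf s' t', hf s' t, hf s t', hf s t]
  ring

/-- A convex function has increasing increments. -/
lemma _root_.ConvexOn.add_le_add_of_le {s : Set ℝ} {G : ℝ → ℝ} (hG : ConvexOn ℝ s G) {y z h : ℝ}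
    (hy : y ∈ s) (hzh : z + h ∈ s) (hyz : y ≤ z) (hh : 0 ≤ h) :
    G (y + h) + G z ≤ G y + G (z + h) := by
  rcases eq_or_lt_of_le (show 0 ≤ z + h - y by linarith) with hL | hL
  · have h1 : h = 0 := by linarith
    have h2 : z = y := by linarith
    subst h1 h2
    simp
  · have q1 : 0 ≤ (z - y) / (z + h - y) := div_nonneg (by linarith) hL.le
    have q2 : 0 ≤ h / (z + h - y) := div_nonneg hh hL.le
    -- The inner points `y + h` and `z` are convex combinations of `y` and `z + h` with interchanged
    -- weights, so adding the two inequalities gives total weight one at each end.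
    have e1 := hG.2 hy hzh q1 q2 (by field_simp; ring)
    have e2 := hG.2 hy hzh q2 q1 (by field_simp; ring)
    have p1 : ((z - y) / (z + h - y)) • y + (h / (z + h - y)) • (z + h) = y + h := by
      simp only [smul_eq_mul]; field_simp; ring
    have p2 : (h / (z + h - y)) • y + ((z - y) / (z + h - y)) • (z + h) = z := by
      simp only [smul_eq_mul]; field_simp; ring
    rw [p1] at e1
    rw [p2] at e2
    have e3 := add_le_add e1 e2
    simp only [smul_eq_mul] at e3
    refine e3.trans_eq ?_
    field_simp
    ring

/-- The variation of a monotone function along increasing points. -/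
lemma sum_abs_sub_of_monotone {p : ℝ → ℝ} (hp : Monotone p) {x : ℕ → ℝ} (hx : Monotone x) (n : ℕ) :
    ∑ k ∈ Finset.range n, |p (x (k + 1)) - p (x k)| = p (x n) - p (x 0) := by
  rw [← Finset.sum_range_sub (fun k => p (x k))]
  exact Finset.sum_congr rfl fun k _ =>
    abs_of_nonneg (sub_nonneg.2 (hp (hx (Nat.le_succ k))))

lemma monotoneOn_rpow_sub_rpow {a h : ℝ} (ha : 0 < a) (ha1 : a ≤ 1) (hh : 0 ≤ h) :
    MonotoneOn (fun y : ℝ => y ^ a - (y + h) ^ a) (Set.Ici 0) := by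
  intro y hy z hz hyz
  have := (Real.concaveOn_rpow ha.le ha1).neg.add_le_add_of_le (y := y) (z := z) (h := h) hy
    (by simp only [Set.mem_Ici] at hz ⊢; linarith) hyz hh
  simp only [Pi.neg_apply] at this
  simp only
  linarith

/-- The variation of `x ↦ |x - b|ᵃ - |x - b'|ᵃ` for `a ≤ 1`. -/
lemma sum_abs_rpow_sub_le_of_le_one {a b b' : ℝ} (ha : 0 < a) (ha1 : a ≤ 1) (hb : b ≤ b')
    {x : ℕ → ℝ} (hx : Monotone x) (n : ℕ) :
    ∑ k ∈ Finset.range n, |(|x (k + 1) - b| ^ a - |x (k + 1) - b'| ^ a) -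
      (|x k - b| ^ a - |x k - b'| ^ a)| ≤ 4 * (b' - b) ^ a := by
  set h := b' - b with hh
  have h0 : 0 ≤ h := sub_nonneg.2 hb
  set φ : ℝ → ℝ := fun y => y ^ a - (y + h) ^ a with hφ
  have hφm := monotoneOn_rpow_sub_rpow ha ha1 h0
  have hφ0 : φ 0 = -h ^ a := by simp [hφ, Real.zero_rpow ha.ne']
  have hφle : ∀ y, 0 ≤ y → φ y ≤ 0 := fun y hy =>
    sub_nonpos.2 (Real.rpow_le_rpow hy (by linarith) ha.le)
  have hφge : ∀ y, 0 ≤ y → -h ^ a ≤ φ y := fun y hy =>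
    hφ0 ▸ hφm (Set.mem_Ici.2 le_rfl) (Set.mem_Ici.2 hy) hy
  -- The function is monotone on each of `x ≤ b`, `b ≤ x ≤ b'` and `b' ≤ x`. The monotone functions
  -- `p1`, `p2`, `p3` carry one piece each and are constant elsewhere; their variations are at most
  -- `h^a`, `2h^a`, `h^a`, whence the factor 4.
  set p1 : ℝ → ℝ := fun x => -φ (max (b - x) 0) with hp1
  set u : ℝ → ℝ := fun x => min (max (x - b) 0) h with hu
  have hu0 : ∀ x, 0 ≤ u x := fun x => le_min (le_max_right _ _) h0
  have huh : ∀ x, u x ≤ h := fun x => min_le_right _ _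
  have hum : Monotone u := fun x y hxy => by
    simp only [hu]
    gcongr
  set p2 : ℝ → ℝ := fun x => u x ^ a - (h - u x) ^ a with hp2
  set p3 : ℝ → ℝ := fun x => φ (max (x - b') 0) with hp3
  have m1 : Monotone p1 := fun x y hxy => neg_le_neg (hφm (Set.mem_Ici.2 (le_max_right _ _))
    (Set.mem_Ici.2 (le_max_right _ _)) (max_le_max (by linarith) le_rfl))
  have m2 : Monotone p2 := fun x y hxy => sub_le_sub
    (Real.rpow_le_rpow (hu0 x) (hum hxy) ha.le)
    (Real.rpow_le_rpow (by linarith [huh y]) (by linarith [hum hxy]) ha.le)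
  have m3 : Monotone p3 := fun x y hxy => hφm (Set.mem_Ici.2 (le_max_right _ _))
    (Set.mem_Ici.2 (le_max_right _ _)) (max_le_max (by linarith) le_rfl)
  have dec : ∀ x : ℝ, |x - b| ^ a - |x - b'| ^ a = -p1 x + p2 x - p3 x := by
    intro x
    simp only [hp1, hp2, hp3, neg_neg]
    rcases le_total x b with hxb | hxb
    · have e : u x = 0 := by
        simp only [hu]; rw [max_eq_right (by linarith), min_eq_left h0]
      rw [e, max_eq_left (show (0:ℝ) ≤ b - x by linarith),
        max_eq_right (show x - b' ≤ 0 by linarith), hφ0, abs_of_nonpos (by linarith),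
        abs_of_nonpos (by linarith), Real.zero_rpow ha.ne']
      simp only [hφ, hh, sub_zero]
      ring_nf
    · rcases le_total x b' with hxb' | hxb'
      · have e : u x = x - b := by
          simp only [hu]; rw [max_eq_left (by linarith), min_eq_left (by linarith)]
        rw [e, max_eq_right (show b - x ≤ 0 by linarith),
          max_eq_right (show x - b' ≤ 0 by linarith), abs_of_nonneg (by linarith),
          abs_of_nonpos (by linarith)]
        simp only [hh]
        ring_nf
      · have e : u x = h := by
          simp only [hu]; rw [max_eq_left (by linarith), min_eq_right (by linarith)]
        rw [e, max_eq_right (show b - x ≤ 0 by linarith),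
          max_eq_left (show (0:ℝ) ≤ x - b' by linarith), hφ0, abs_of_nonneg (by linarith),
          abs_of_nonneg (by linarith), sub_self, Real.zero_rpow ha.ne']
        simp only [hφ, hh]
        ring_nf
  have bound : ∀ y z : ℝ, |(|y - b| ^ a - |y - b'| ^ a) - (|z - b| ^ a - |z - b'| ^ a)| ≤
      |p1 y - p1 z| + |p2 y - p2 z| + |p3 y - p3 z| := by
    intro y z
    rw [dec y, dec z]
    have e : -p1 y + p2 y - p3 y - (-p1 z + p2 z - p3 z) =
        -(p1 y - p1 z) + (p2 y - p2 z) + -(p3 y - p3 z) := by ring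
    rw [e]
    refine (abs_add_three _ _ _).trans ?_
    rw [abs_neg, abs_neg]
  refine (Finset.sum_le_sum fun k _ => bound _ _).trans ?_
  rw [Finset.sum_add_distrib, Finset.sum_add_distrib, sum_abs_sub_of_monotone m1 hx,
    sum_abs_sub_of_monotone m2 hx, sum_abs_sub_of_monotone m3 hx]
  have b1 : p1 (x n) - p1 (x 0) ≤ h ^ a := by
    have e1 := hφge (max (b - x n) 0) (le_max_right _ _)
    have e2 := hφle (max (b - x 0) 0) (le_max_right _ _)
    simp only [hp1]
    linarith
  have b3 : p3 (x n) - p3 (x 0) ≤ h ^ a := by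
    have e1 := hφge (max (x 0 - b') 0) (le_max_right _ _)
    have e2 := hφle (max (x n - b') 0) (le_max_right _ _)
    simp only [hp3]
    linarith
  have hp2b : ∀ x, -h ^ a ≤ p2 x ∧ p2 x ≤ h ^ a := fun x => by
    have e1 := Real.rpow_nonneg (hu0 x) a
    have e2 : 0 ≤ (h - u x) ^ a := Real.rpow_nonneg (by linarith [huh x]) a
    have e3 := Real.rpow_le_rpow (hu0 x) (huh x) ha.le
    have e4 : (h - u x) ^ a ≤ h ^ a :=
      Real.rpow_le_rpow (by linarith [huh x]) (by linarith [hu0 x]) ha.le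
    constructor <;> simp only [hp2] <;> linarith
  linarith [(hp2b (x n)).2, (hp2b (x 0)).1]

lemma convexOn_abs_rpow {a : ℝ} (ha : 1 ≤ a) : ConvexOn ℝ Set.univ fun y : ℝ => |y| ^ a := by
  refine ⟨convex_univ, fun x _ y _ s t hs ht hst => ?_⟩
  refine le_trans ?_ ((convexOn_rpow ha).2 (Set.mem_Ici.2 (abs_nonneg x))
    (Set.mem_Ici.2 (abs_nonneg y)) hs ht hst)
  refine Real.rpow_le_rpow (abs_nonneg _) ?_ (by linarith)
  refine (abs_add_le _ _).trans_eq ?_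
  simp [abs_mul, abs_of_nonneg hs, abs_of_nonneg ht]

/-- The power function with exponent in `[1,2]` is Lipschitz on `[0,1]`. -/
lemma rpow_sub_rpow_le {a x y : ℝ} (ha : 1 ≤ a) (ha2 : a ≤ 2) (hx : 0 ≤ x) (hxy : x ≤ y)
    (hy : y ≤ 1) : y ^ a - x ^ a ≤ 2 * (y - x) := by
  rcases eq_or_lt_of_le (hx.trans hxy) with h0 | h0
  · have : x = 0 := by linarith
    rw [← h0, this]
    simp
  · have hb := one_add_mul_self_le_rpow_one_add (s := x / y - 1)
      (by linarith [div_nonneg hx h0.le]) ha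
    rw [add_sub_cancel, Real.div_rpow hx h0.le] at hb
    have hya : 0 < y ^ a := Real.rpow_pos_of_pos h0 a
    rw [le_div_iff₀ hya] at hb
    have e1 : y ^ a = y ^ (a - 1) * y := by
      rw [Real.rpow_sub_one h0.ne']; field_simp
    have e2 : y ^ (a - 1) ≤ 1 := Real.rpow_le_one h0.le hy (by linarith)
    have e3 : 0 ≤ y ^ (a - 1) := Real.rpow_nonneg h0.le _
    have e4 : y ^ a * (x / y - 1) = y ^ (a - 1) * (x - y) := by
      rw [e1]; field_simp
    have e5 : y ^ a - x ^ a ≤ a * (y ^ (a - 1) * (y - x)) := by nlinarith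
    have e6 : y ^ (a - 1) * (y - x) ≤ y - x := by nlinarith
    have e7 : 0 ≤ y ^ (a - 1) * (y - x) := mul_nonneg e3 (by linarith)
    nlinarith

/-- The variation of `x ↦ |x - b|ᵃ - |x - b'|ᵃ` on `[0,1]` for `1 ≤ a ≤ 2`. -/
lemma sum_abs_rpow_sub_le_of_one_le {a b b' : ℝ} (ha : 1 ≤ a) (ha2 : a ≤ 2) (hb0 : 0 ≤ b)
    (hb : b ≤ b') (hb1 : b' ≤ 1) {x : ℕ → ℝ} (hx : Monotone x) (n : ℕ) (h0 : x 0 = 0)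
    (h1 : x n = 1) :
    ∑ k ∈ Finset.range n, |(|x (k + 1) - b| ^ a - |x (k + 1) - b'| ^ a) -
      (|x k - b| ^ a - |x k - b'| ^ a)| ≤ 4 * (b' - b) := by
  -- By convexity of `|·|^a` the function is monotone, so its variation is the difference of its end
  -- values.
  have hm : Monotone fun x : ℝ => |x - b| ^ a - |x - b'| ^ a := by
    intro y z hyz
    have := (convexOn_abs_rpow ha).add_le_add_of_le (y := y - b') (z := z - b') (h := b' - b)
      trivial trivial (by linarith) (by linarith)
    simp only [sub_add_sub_cancel] at this
    simp only
    linarith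
  rw [sum_abs_sub_of_monotone hm hx, h0, h1]
  simp only [zero_sub, abs_neg]
  rw [abs_of_nonneg (by linarith : 0 ≤ b), abs_of_nonneg (by linarith : 0 ≤ b'),
    abs_of_nonneg (by linarith : 0 ≤ 1 - b), abs_of_nonneg (by linarith : 0 ≤ 1 - b')]
  have e1 := rpow_sub_rpow_le ha ha2 hb0 hb hb1
  have e2 := rpow_sub_rpow_le ha ha2 (x := 1 - b') (y := 1 - b) (by linarith) (by linarith)
    (by linarith)
  linarith

/-- The one-dimensional variation of the increments of the covariance function. -/
theorem sum_abs_rect_fbmCov_le {a : ℝ} (ha : 0 < a) (ha2 : a ≤ 2) (D : Partition) (b b' : Time) :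
    ∑ k ∈ Finset.range D.n, |rect (fbmCov a) (D.pt k) (D.pt (k + 1)) b b'| ≤
      2 * |(b' : ℝ) - b| ^ min 1 a := by
  wlog hb : b ≤ b' generalizing b b'
  · have := this b' b (le_of_not_ge hb)
    rw [abs_sub_comm]
    refine le_trans (Finset.sum_le_sum fun k _ => ?_) this
    rw [rect_swap, abs_neg]
  have hb' : (b : ℝ) ≤ b' := hb
  have hx : Monotone fun k => (D.pt k : ℝ) := fun i j hij => D.mono hij
  have key : ∑ k ∈ Finset.range D.n, |(|(D.pt (k + 1) : ℝ) - b| ^ a - |(D.pt (k + 1) : ℝ) - b'| ^ a)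
      - (|(D.pt k : ℝ) - b| ^ a - |(D.pt k : ℝ) - b'| ^ a)| ≤ 4 * ((b' : ℝ) - b) ^ min 1 a := by
    rcases le_total a 1 with h | h
    · rw [min_eq_right h]
      exact sum_abs_rpow_sub_le_of_le_one ha h hb' hx D.n
    · rw [min_eq_left h, Real.rpow_one]
      exact sum_abs_rpow_sub_le_of_one_le h ha2 b.2.1 hb' b'.2.2 hx D.n (by simp [D.first])
        (by simp [D.last])
  rw [abs_of_nonneg (sub_nonneg.2 hb')]
  have e : ∀ k, |rect (fbmCov a) (D.pt k) (D.pt (k + 1)) b b'| =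
      |(|(D.pt (k + 1) : ℝ) - b| ^ a - |(D.pt (k + 1) : ℝ) - b'| ^ a)
      - (|(D.pt k : ℝ) - b| ^ a - |(D.pt k : ℝ) - b'| ^ a)| / 2 := by
    intro k
    rw [rect_fbmCov, abs_div, abs_two]
  simp only [e, ← Finset.sum_div]
  linarith

lemma Partition.sum_sub (D : Partition) (f : Time → ℝ) :
    ∑ k ∈ Finset.range D.n, (f (D.pt (k + 1)) - f (D.pt k)) = f 1 - f 0 := by
  rw [Finset.sum_range_sub (fun k => f (D.pt k)), D.last, D.first]

/-- Each term satisfies `cᵢ^p = cᵢ cᵢ^(p-1) ≤ cᵢ S^(p-1)`, where `S` is the total. -/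
lemma sum_rpow_le_rpow_sum {p : ℝ} (hp : 1 ≤ p) {ι : Type*} (s : Finset ι) {c : ι → ℝ}
    (hc : ∀ i ∈ s, 0 ≤ c i) : ∑ i ∈ s, c i ^ p ≤ (∑ i ∈ s, c i) ^ p := by
  have hS : 0 ≤ ∑ i ∈ s, c i := Finset.sum_nonneg hc
  have e : ∀ x : ℝ, 0 ≤ x → x ^ p = x * x ^ (p - 1) := by
    intro x hx
    rw [← Real.rpow_one_add' hx (by linarith)]
    ring_nf
  rw [e _ hS, Finset.sum_mul]
  refine Finset.sum_le_sum fun i hi => ?_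
  rw [e _ (hc i hi)]
  exact mul_le_mul_of_nonneg_left (Real.rpow_le_rpow (hc i hi)
    (Finset.single_le_sum hc hi) (by linarith)) (hc i hi)

/-- The covariance function of fractional Brownian motion has finite `max 1 (1/a)`-variation. -/
theorem hasFinitePVariation_fbmCov {a : ℝ} (ha : 0 < a) (ha2 : a ≤ 2) :
    HasFinitePVariation (max 1 (1 / a)) (fbmCov a) := by
  set p := max 1 (1 / a) with hp
  have hp1 : 1 ≤ p := le_max_left _ _
  -- This choice of `p` turns the bound `2 h^(min 1 a)` for a strip of height `h` into `2^p h` after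
  -- taking `p`-th powers, and the heights sum to 1.
  have hmp : min 1 a * p = 1 := by
    rcases le_total a 1 with h | h
    · rw [hp, min_eq_right h, max_eq_right ((one_le_div ha).2 h)]
      field_simp
    · rw [hp, min_eq_left h, max_eq_left ((div_le_one ha).2 h)]
      norm_num
  have key : ∀ D D' : Partition, ∑ k ∈ Finset.range D.n, ∑ l ∈ Finset.range D'.n,
      |cell (fbmCov a) D D' k l| ^ p ≤ 2 ^ p := by
    intro D D'
    rw [Finset.sum_comm]
    have row : ∀ l, ∑ k ∈ Finset.range D.n, |cell (fbmCov a) D D' k l| ^ p ≤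
        2 ^ p * ((D'.pt (l + 1) : ℝ) - D'.pt l) := by
      intro l
      refine (sum_rpow_le_rpow_sum hp1 _ fun _ _ => abs_nonneg _).trans ?_
      refine (Real.rpow_le_rpow (Finset.sum_nonneg fun _ _ => abs_nonneg _)
        (sum_abs_rect_fbmCov_le ha ha2 D (D'.pt l) (D'.pt (l + 1))) (by linarith)).trans_eq ?_
      rw [Real.mul_rpow (by norm_num) (by positivity), ← Real.rpow_mul (abs_nonneg _), hmp,
        Real.rpow_one, abs_of_nonneg (sub_nonneg.2 (show (D'.pt l : ℝ) ≤ D'.pt (l + 1) from D'.mono (Nat.le_succ l)))]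
    refine (Finset.sum_le_sum fun l _ => row l).trans_eq ?_
    rw [← Finset.mul_sum, D'.sum_sub (fun t => (t : ℝ))]
    simp
  unfold HasFinitePVariation pVariation
  refine lt_of_le_of_lt (b := (ENNReal.ofReal (2 ^ p)) ^ (1 / p)) (iSup₂_le fun D D' => ?_)
    (ENNReal.rpow_lt_top_of_nonneg (by positivity) ENNReal.ofReal_ne_top)
  refine ENNReal.rpow_le_rpow ?_ (by positivity)
  refine le_trans (le_of_eq ?_) (ENNReal.ofReal_le_ofReal (key D D'))
  rw [ENNReal.ofReal_sum_of_nonneg fun k _ => Finset.sum_nonneg fun l _ => by positivity]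
  exact Finset.sum_congr rfl fun k _ => by
    rw [ENNReal.ofReal_sum_of_nonneg fun l _ => by positivity]

/-! ### Uniform partitions and the lower bound on variation exponents -/

/-- The uniform partition of `[0,1]` into `N + 1` intervals. -/
def uniform (N : ℕ) : Partition where
  n := N + 1
  pt k := ⟨min (k / (N + 1 : ℝ)) 1, le_min (by positivity) zero_le_one, min_le_right _ _⟩
  mono i j hij := by
    change min ((i : ℝ) / (N + 1)) 1 ≤ min ((j : ℝ) / (N + 1)) 1
    gcongr
  first := by ext; simp
  last := by
    ext
    push_cast
    rw [div_self (by positivity)]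
    simp

lemma coe_uniform_pt {N k : ℕ} (hk : k ≤ N + 1) : ((uniform N).pt k : ℝ) = k / (N + 1 : ℝ) := by
  change min ((k : ℝ) / (N + 1)) 1 = _
  refine min_eq_left ?_
  rw [div_le_one (by positivity)]
  exact_mod_cast hk

/-- Only exponents at least `1/a` are variation exponents. -/
theorem one_le_mul_of_hasFinitePVariation {a p : ℝ} (ha : 0 < a) (hp : 1 ≤ p)
    (h : HasFinitePVariation p (fbmCov a)) : 1 ≤ a * p := by
  by_contra! hlt
  set M := pVariation p (fbmCov a) with hM
  have hMtop : M ≠ ⊤ := h.ne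
  -- Only the diagonal squares are kept; the increment over each is the variance `(N+1)^(-a)` of an
  -- increment of the process. For `a p < 1` the left side is unbounded in `N`.
  have low : ∀ N : ℕ, ((N + 1 : ℕ) : ℝ) ^ (1 - a * p) ≤ M.toReal ^ p := by
    intro N
    have h1 : (∑ k ∈ Finset.range (uniform N).n, ∑ l ∈ Finset.range (uniform N).n,
        ENNReal.ofReal (|cell (fbmCov a) (uniform N) (uniform N) k l| ^ p)) ^ (1 / p) ≤ M :=
      le_iSup₂ (f := fun D D' : Partition => (∑ k ∈ Finset.range D.n, ∑ l ∈ Finset.range D'.n,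
        ENNReal.ofReal (|cell (fbmCov a) D D' k l| ^ p)) ^ (1 / p)) (uniform N) (uniform N)
    have h2 : (∑ k ∈ Finset.range (uniform N).n, ∑ l ∈ Finset.range (uniform N).n,
        ENNReal.ofReal (|cell (fbmCov a) (uniform N) (uniform N) k l| ^ p)) ≤ M ^ p := by
      have := ENNReal.rpow_le_rpow h1 (by linarith : (0 : ℝ) ≤ p)
      rwa [← ENNReal.rpow_mul, one_div_mul_cancel (by linarith), ENNReal.rpow_one] at this
    have h3 : ENNReal.ofReal (((N + 1 : ℕ) : ℝ) ^ (1 - a * p)) ≤ M ^ p := by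
      refine le_trans ?_ h2
      calc ENNReal.ofReal (((N + 1 : ℕ) : ℝ) ^ (1 - a * p))
          = ∑ k ∈ Finset.range (N + 1), ENNReal.ofReal (((N + 1 : ℕ) : ℝ) ^ (-(a * p))) := by
            rw [Finset.sum_const, Finset.card_range, nsmul_eq_mul,
              ← ENNReal.ofReal_natCast, ← ENNReal.ofReal_mul (by positivity),
              ← Real.rpow_one_add' (by positivity) (by linarith)]
            ring_nf
        _ = ∑ k ∈ Finset.range (N + 1),
              ENNReal.ofReal (|cell (fbmCov a) (uniform N) (uniform N) k k| ^ p) := by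
            refine Finset.sum_congr rfl fun k hk => ?_
            have hk' := Finset.mem_range.1 hk
            congr 1
            rw [cell, rect_fbmCov, coe_uniform_pt hk'.le, coe_uniform_pt (Nat.succ_le_of_lt hk')]
            have e1 : ((k + 1 : ℕ) : ℝ) / (N + 1) - k / (N + 1) = ((N + 1 : ℕ) : ℝ)⁻¹ := by
              push_cast; field_simp; ring
            have e2 : |(k : ℝ) / (N + 1) - ((k + 1 : ℕ) : ℝ) / (N + 1)| = ((N + 1 : ℕ) : ℝ)⁻¹ := by
              rw [abs_sub_comm, e1, abs_of_nonneg (by positivity)]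
            rw [e1, e2, sub_self, sub_self, abs_of_nonneg (a := (((N + 1 : ℕ) : ℝ)⁻¹))
              (by positivity), abs_zero, Real.zero_rpow ha.ne']
            rw [show (((N + 1 : ℕ) : ℝ)⁻¹ ^ a - 0 - (0 - ((N + 1 : ℕ) : ℝ)⁻¹ ^ a)) / 2 =
              ((N + 1 : ℕ) : ℝ)⁻¹ ^ a by ring, abs_of_nonneg (by positivity),
              ← Real.rpow_mul (by positivity), Real.inv_rpow (by positivity), Real.rpow_neg
              (by positivity)]
        _ ≤ _ := Finset.sum_le_sum fun k hk => Finset.single_le_sum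
              (f := fun l => ENNReal.ofReal (|cell (fbmCov a) (uniform N) (uniform N) k l| ^ p))
              (fun _ _ => zero_le) hk
    rw [ENNReal.toReal_rpow]
    exact (ENNReal.ofReal_le_iff_le_toReal
      (ENNReal.rpow_ne_top_of_nonneg (by linarith) hMtop)).1 h3
  have ht : Filter.Tendsto (fun N : ℕ => ((N + 1 : ℕ) : ℝ) ^ (1 - a * p)) Filter.atTop
      Filter.atTop :=
    (tendsto_rpow_atTop (by linarith)).comp
      (tendsto_natCast_atTop_atTop.comp (Filter.tendsto_add_atTop_nat 1))
  obtain ⟨N, hN⟩ := (ht.eventually_gt_atTop (M.toReal ^ p)).exists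
  exact absurd (low N) (not_le.2 hN)

/-! ### Riemann-Stieltjes integrals -/

lemma Partition.MeshLT.mono {D : Partition} {δ δ' : ℝ} (h : D.MeshLT δ) (hδ : δ ≤ δ') :
    D.MeshLT δ' := fun k hk => (h k hk).trans_le hδ

lemma HasRSIntegral.zero (R : Time → Time → ℝ) : HasRSIntegral (fun _ _ => 0) R 0 :=
  fun ε hε => ⟨1, one_pos, fun D D' _ _ ν μ _ _ => by simpa using hε⟩

lemma HasRSIntegral.add {f g R : Time → Time → ℝ} {v w : ℝ} (hf : HasRSIntegral f R v)
    (hg : HasRSIntegral g R w) : HasRSIntegral (fun s t => f s t + g s t) R (v + w) := by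
  intro ε hε
  obtain ⟨δ, hδ, h⟩ := hf (ε / 2) (half_pos hε)
  obtain ⟨δ', hδ', h'⟩ := hg (ε / 2) (half_pos hε)
  refine ⟨min δ δ', lt_min hδ hδ', fun D D' hD hD' ν μ hν hμ => ?_⟩
  have e1 := h D D' (hD.mono (min_le_left _ _)) (hD'.mono (min_le_left _ _)) ν μ hν hμ
  have e2 := h' D D' (hD.mono (min_le_right _ _)) (hD'.mono (min_le_right _ _)) ν μ hν hμ
  simp only [add_mul, Finset.sum_add_distrib]
  rw [add_sub_add_comm]
  exact (abs_add_le _ _).trans_lt (by linarith)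

lemma HasRSIntegral.const_mul {f R : Time → Time → ℝ} {v : ℝ} (hf : HasRSIntegral f R v) (c : ℝ) :
    HasRSIntegral (fun s t => c * f s t) R (c * v) := by
  intro ε hε
  obtain ⟨δ, hδ, h⟩ := hf (ε / (|c| + 1)) (by positivity)
  refine ⟨δ, hδ, fun D D' hD hD' ν μ hν hμ => ?_⟩
  have e1 := h D D' hD hD' ν μ hν hμ
  simp only [mul_assoc, ← Finset.mul_sum]
  rw [← mul_sub, abs_mul]
  rw [lt_div_iff₀ (by positivity)] at e1
  nlinarith [abs_nonneg c, abs_nonneg (∑ k ∈ Finset.range D.n, ∑ l ∈ Finset.range D'.n,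
        f (ν k) (μ l) * cell R D D' k l - v)]

lemma HasRSIntegral.sub {f g R : Time → Time → ℝ} {v w : ℝ} (hf : HasRSIntegral f R v)
    (hg : HasRSIntegral g R w) : HasRSIntegral (fun s t => f s t - g s t) R (v - w) := by
  convert! hf.add (hg.const_mul (-1)) using 1
  · funext s t; ring
  · ring

lemma HasQuadIntegral.zero_left (g R R' : Time → Time → ℝ) :
    HasQuadIntegral (fun _ _ => 0) g R R' 0 :=
  ⟨fun _ _ => 0, fun u v => by simpa using HasRSIntegral.zero R, HasRSIntegral.zero R'⟩

lemma HasQuadIntegral.zero_right (f R R' : Time → Time → ℝ) :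
    HasQuadIntegral f (fun _ _ => 0) R R' 0 :=
  ⟨fun _ _ => 0, fun u v => by simpa using HasRSIntegral.zero R, HasRSIntegral.zero R'⟩

lemma HasQuadIntegral.add {f g g' R R' : Time → Time → ℝ} {v w : ℝ}
    (h : HasQuadIntegral f g R R' v) (h' : HasQuadIntegral f g' R R' w) :
    HasQuadIntegral f (fun s t => g s t + g' s t) R R' (v + w) := by
  obtain ⟨F, h1, h2⟩ := h
  obtain ⟨F', h1', h2'⟩ := h'
  refine ⟨fun u v => F u v + F' u v, fun u v => ?_, h2.add h2'⟩
  convert! (h1 u v).add (h1' u v) using 1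
  funext s t
  ring

lemma HasQuadIntegral.const_mul {f g R R' : Time → Time → ℝ} {v : ℝ}
    (h : HasQuadIntegral f g R R' v) (c : ℝ) :
    HasQuadIntegral f (fun s t => c * g s t) R R' (c * v) := by
  obtain ⟨F, h1, h2⟩ := h
  refine ⟨fun u v => c * F u v, fun u v => ?_, h2.const_mul c⟩
  convert! (h1 u v).const_mul c using 1
  funext s t
  ring

lemma HasQuadIntegral.neg_left {f g R R' : Time → Time → ℝ} {v : ℝ}
    (h : HasQuadIntegral f g R R' v) : HasQuadIntegral (fun s t => -f s t) g R R' (-v) := by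
  obtain ⟨F, h1, h2⟩ := h
  refine ⟨fun u v => -1 * F u v, fun u v => ?_, by simpa using h2.const_mul (-1)⟩
  convert! (h1 u v).const_mul (-1) using 1
  funext s t
  ring

/-! ### One-dimensional Riemann–Stieltjes integrals -/

/-- The one-dimensional Riemann-Stieltjes integral `∫ Φ dΨ` exists and equals `w`. -/
def HasRSIntegral₁ (Φ Ψ : Time → ℝ) (w : ℝ) : Prop :=
  ∀ ε > 0, ∃ δ > 0, ∀ D : Partition, D.MeshLT δ → ∀ ν : ℕ → Time, D.IsTag ν →
    |(∑ k ∈ Finset.range D.n, Φ (ν k) * (Ψ (D.pt (k + 1)) - Ψ (D.pt k))) - w| < ε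

lemma HasRSIntegral₁.add {Φ Ψ Ψ' : Time → ℝ} {v w : ℝ} (h : HasRSIntegral₁ Φ Ψ v)
    (h' : HasRSIntegral₁ Φ Ψ' w) : HasRSIntegral₁ Φ (fun t => Ψ t + Ψ' t) (v + w) := by
  intro ε hε
  obtain ⟨δ, hδ, h⟩ := h (ε / 2) (half_pos hε)
  obtain ⟨δ', hδ', h'⟩ := h' (ε / 2) (half_pos hε)
  refine ⟨min δ δ', lt_min hδ hδ', fun D hD ν hν => ?_⟩
  have e1 := h D (hD.mono (min_le_left _ _)) ν hν
  have e2 := h' D (hD.mono (min_le_right _ _)) ν hν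
  simp only [add_sub_add_comm, mul_add, Finset.sum_add_distrib]
  exact (abs_add_le _ _).trans_lt (by linarith)

lemma HasRSIntegral₁.const_mul {Φ Ψ : Time → ℝ} {v : ℝ} (h : HasRSIntegral₁ Φ Ψ v) (c : ℝ) :
    HasRSIntegral₁ Φ (fun t => c * Ψ t) (c * v) := by
  intro ε hε
  obtain ⟨δ, hδ, h⟩ := h (ε / (|c| + 1)) (by positivity)
  refine ⟨δ, hδ, fun D hD ν hν => ?_⟩
  have e1 := h D hD ν hν
  simp only [← mul_sub, mul_left_comm _ c, ← Finset.mul_sum]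
  rw [abs_mul]
  rw [lt_div_iff₀ (by positivity)] at e1
  nlinarith [abs_nonneg c, abs_nonneg (∑ k ∈ Finset.range D.n,
    Φ (ν k) * (Ψ (D.pt (k + 1)) - Ψ (D.pt k)) - v)]

lemma HasRSIntegral₁.const (Φ : Time → ℝ) (c : ℝ) : HasRSIntegral₁ Φ (fun _ => c) 0 :=
  fun ε hε => ⟨1, one_pos, fun D _ ν _ => by simpa using hε⟩

/-- A continuous function is integrable against a continuous monotone one. -/
lemma exists_hasRSIntegral₁_of_monotone {Φ : Time → ℝ} (hΦ : Continuous Φ) {m : ℝ → ℝ}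
    (hm : Monotone m) (hc : Continuous m) : ∃ w, HasRSIntegral₁ Φ (fun t => m t) w := by
  -- The value is the integral of `Φ` against the measure of `m`; uniform continuity of `Φ` compares
  -- it with the Riemann sums interval by interval.
  let f : StieltjesFunction ℝ := ⟨m, hm, fun x => hc.continuousWithinAt⟩
  have hf : ∀ x, f x = m x := fun _ => rfl
  let G : ℝ → ℝ := fun x => Φ (Set.projIcc 0 1 zero_le_one x)
  have hG : Continuous G := hΦ.comp continuous_projIcc
  refine ⟨∫ x in (0:ℝ)..1, G x ∂f.measure, fun ε hε => ?_⟩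
  have hM : 0 ≤ m 1 - m 0 := sub_nonneg.2 (hm zero_le_one)
  set η := ε / (m 1 - m 0 + 1) with hη
  have hη0 : 0 < η := by positivity
  obtain ⟨δ, hδ, hu⟩ := Metric.uniformContinuous_iff.1
    (CompactSpace.uniformContinuous_of_continuous hΦ) η hη0
  refine ⟨δ, hδ, fun D hD ν hν => ?_⟩
  have hle : ∀ k, (D.pt k : ℝ) ≤ D.pt (k + 1) := fun k => D.mono (Nat.le_succ k)
  have split := intervalIntegral.sum_integral_adjacent_intervals (μ := f.measure) (f := G)
    (a := fun k => (D.pt k : ℝ)) (n := D.n) (fun k _ => hG.intervalIntegrable _ _)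
  simp only [D.first, D.last] at split
  rw [show ((0 : Time) : ℝ) = 0 from rfl, show ((1 : Time) : ℝ) = 1 from rfl] at split
  rw [← split, ← Finset.sum_sub_distrib]
  have term : ∀ k ∈ Finset.range D.n, |Φ (ν k) * (m (D.pt (k + 1)) - m (D.pt k)) -
      ∫ x in (D.pt k : ℝ)..D.pt (k + 1), G x ∂f.measure| ≤
        η * (m (D.pt (k + 1)) - m (D.pt k)) := by
    intro k hk
    have hk := Finset.mem_range.1 hk
    have hreal : f.measure.real (Set.Ioc (D.pt k : ℝ) (D.pt (k + 1))) =
        m (D.pt (k + 1)) - m (D.pt k) := by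
      rw [Measure.real, StieltjesFunction.measure_Ioc, ENNReal.toReal_ofReal, hf, hf]
      exact sub_nonneg.2 (hm (hle k))
    have hfin : f.measure (Set.Ioc (D.pt k : ℝ) (D.pt (k + 1))) < ⊤ := by
      rw [StieltjesFunction.measure_Ioc]; exact ENNReal.ofReal_lt_top
    have hint : IntegrableOn G (Set.Ioc (D.pt k : ℝ) (D.pt (k + 1))) f.measure :=
      (intervalIntegrable_iff_integrableOn_Ioc_of_le (hle k)).1 (hG.intervalIntegrable _ _)
    rw [intervalIntegral.integral_of_le (hle k)]
    have e : Φ (ν k) * (m (D.pt (k + 1)) - m (D.pt k)) =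
        ∫ _ in Set.Ioc (D.pt k : ℝ) (D.pt (k + 1)), Φ (ν k) ∂f.measure := by
      rw [setIntegral_const, hreal, smul_eq_mul, mul_comm]
    have hcst : IntegrableOn (fun _ : ℝ => Φ (ν k)) (Set.Ioc (D.pt k : ℝ) (D.pt (k + 1)))
        f.measure := integrableOn_const hfin.ne
    rw [e, ← integral_sub hcst hint, ← hreal, ← Real.norm_eq_abs]
    refine norm_setIntegral_le_of_norm_le_const hfin fun x hx => ?_
    have hx01 : x ∈ Set.Icc (0 : ℝ) 1 :=
      ⟨(D.pt k).2.1.trans hx.1.le, hx.2.trans (D.pt (k + 1)).2.2⟩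
    have hGx : G x = Φ ⟨x, hx01⟩ := by
      simp only [G, Set.projIcc_of_mem zero_le_one hx01]
    rw [hGx, ← dist_eq_norm]
    refine (hu ?_).le
    have h1 : (D.pt k : ℝ) ≤ ν k := (hν k hk).1
    have h2 : (ν k : ℝ) ≤ D.pt (k + 1) := (hν k hk).2
    have h3 := hD k hk
    rw [Subtype.dist_eq, Real.dist_eq, abs_lt]
    constructor <;> linarith [hx.1, hx.2]
  refine (Finset.abs_sum_le_sum_abs _ _).trans_lt ?_
  refine (Finset.sum_le_sum term).trans_lt ?_
  rw [← Finset.mul_sum, D.sum_sub (fun t => m t)]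
  change η * (m 1 - m 0) < ε
  calc η * (m 1 - m 0) < η * (m 1 - m 0 + 1) := by nlinarith
    _ = ε := by rw [hη]; field_simp

lemma continuous_fbmCov {a : ℝ} (ha : 0 < a) :
    Continuous fun x : Time × Time => fbmCov a x.1 x.2 := by
  unfold fbmCov
  have := ha.le
  fun_prop (disch := assumption)

lemma continuous_fbmCov_left {a : ℝ} (ha : 0 < a) (τ : Time) :
    Continuous fun u : Time => fbmCov a u τ - fbmCov a 1 τ / 2 :=
  ((continuous_fbmCov ha).comp (by fun_prop : Continuous fun u : Time => (u, τ))).sub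
    continuous_const

/-- A continuous function is integrable against the sections of the covariance function. -/
theorem exists_hasRSIntegral₁_fbmCov {Φ : Time → ℝ} (hΦ : Continuous Φ) {a : ℝ} (ha : 0 < a)
    (σ : Time) : ∃ w, HasRSIntegral₁ Φ (fun t => fbmCov a t σ) w := by
  have hp : Continuous fun y : ℝ => (max y 0) ^ a := by
    have := ha.le
    fun_prop (disch := assumption)
  have hpm : Monotone fun y : ℝ => (max y 0) ^ a := fun x y h =>
    Real.rpow_le_rpow (le_max_right _ _) (max_le_max h le_rfl) ha.le
  -- On `[0,1]`, `2R(t,σ) = t^a + σ^a - (t-σ)₊^a - (σ-t)₊^a`, a combination of three continuous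
  -- monotone functions and a constant.
  obtain ⟨w1, h1⟩ := exists_hasRSIntegral₁_of_monotone hΦ hpm hp
  obtain ⟨w2, h2⟩ := exists_hasRSIntegral₁_of_monotone hΦ
    (m := fun x => (max (x - σ) 0) ^ a) (fun x y h => hpm (by linarith))
    (hp.comp (continuous_id.sub continuous_const))
  obtain ⟨w3, h3⟩ := exists_hasRSIntegral₁_of_monotone hΦ
    (m := fun x => -(max (σ - x) 0) ^ a) (fun x y h => neg_le_neg (hpm (by linarith)))
    (hp.comp (continuous_const.sub continuous_id)).neg
  refine ⟨_, cast (congrArg (fun Ψ => HasRSIntegral₁ Φ Ψ _) (funext fun t => ?_))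
    (((h1.add (HasRSIntegral₁.const Φ ((σ : ℝ) ^ a))).add
      ((h2.const_mul (-1)).add h3)).const_mul (1 / 2))⟩
  simp only [fbmCov]
  rw [max_eq_left t.2.1]
  rcases le_total (t : ℝ) σ with h | h
  · rw [max_eq_right (sub_nonpos.2 h), max_eq_left (sub_nonneg.2 h), abs_of_nonpos
      (sub_nonpos.2 h), Real.zero_rpow ha.ne', neg_sub]
    ring
  · rw [max_eq_left (sub_nonneg.2 h), max_eq_right (sub_nonpos.2 h), abs_of_nonneg
      (sub_nonneg.2 h), Real.zero_rpow ha.ne']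
    ring

/-! ### Integrals of indicators of initial segments -/

/-- `A` is an initial segment of `[0,1]` with endpoint `a`. -/
def IsCut (A : Time → Prop) (a : Time) : Prop := (∀ s < a, A s) ∧ ∀ s, a < s → ¬ A s

lemma isCut_le (a : Time) : IsCut (· ≤ a) a := ⟨fun _ h => h.le, fun _ h => not_le.2 h⟩

lemma isCut_lt (a : Time) : IsCut (· < a) a := ⟨fun _ h => h, fun _ h => not_lt.2 h.le⟩

/-- Tags increase with their index, so the tags in `A` form an initial block, and the grid point
where it ends is within one mesh of `a`. Leaving open whether `a` belongs to `A` lets strict and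
weak inequalities be treated together. -/
lemma IsCut.exists_index {A : Time → Prop} {a : Time} (hA : IsCut A a) {D : Partition} {δ : ℝ}
    (hδ : 0 < δ) (hD : D.MeshLT δ) {ν : ℕ → Time} (hν : D.IsTag ν) :
    ∃ m ≤ D.n, |(D.pt m : ℝ) - a| < δ ∧ ∀ k < D.n, A (ν k) ↔ k < m := by
  classical
  -- The alternative `D.n ≤ k` supplies the index when every tag lies in `A`.
  have hex : ∃ k, D.n ≤ k ∨ ¬ A (ν k) := ⟨D.n, Or.inl le_rfl⟩
  have hle : Nat.find hex ≤ D.n := Nat.find_min' hex (Or.inl le_rfl)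
  have hlt : ∀ k < Nat.find hex, A (ν k) := fun k hk => by
    have := Nat.find_min hex hk
    push Not at this
    exact this.2
  refine ⟨Nat.find hex, hle, ?_, fun k hk => ⟨fun h => ?_, hlt k⟩⟩
  · rw [abs_lt]
    constructor
    · rcases hle.lt_or_eq with h | h
      · have hn : ¬ A (ν (Nat.find hex)) := (Nat.find_spec hex).resolve_left (not_le.2 h)
        have h1 : (a : ℝ) ≤ ν (Nat.find hex) := by
          by_contra! hc
          exact hn (hA.1 _ hc)
        have h2 : (ν (Nat.find hex) : ℝ) ≤ D.pt (Nat.find hex + 1) := (hν _ h).2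
        linarith [hD _ h]
      · rw [h, D.last]
        have : (a : ℝ) ≤ 1 := a.2.2
        change -δ < 1 - (a : ℝ)
        linarith
    · rcases Nat.eq_zero_or_pos (Nat.find hex) with h | h
      · rw [h, D.first]
        have : (0 : ℝ) ≤ a := a.2.1
        change 0 - (a : ℝ) < δ
        linarith
      · obtain ⟨j, hj⟩ := Nat.exists_eq_succ_of_ne_zero h.ne'
        have hjn : j < D.n := by omega
        have h1 : (ν j : ℝ) ≤ a := by
          by_contra! hc
          exact hA.2 _ hc (hlt j (by omega))
        have h2 : (D.pt j : ℝ) ≤ ν j := (hν j hjn).1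
        have h3 := hD j hjn
        rw [hj]
        change (D.pt (j + 1) : ℝ) - a < δ
        linarith
  · by_contra! hc
    have hm : Nat.find hex < D.n := lt_of_le_of_lt hc hk
    have hn : ¬ A (ν (Nat.find hex)) := (Nat.find_spec hex).resolve_left (not_le.2 hm)
    have h1 : a ≤ ν (Nat.find hex) := by
      by_contra! h'
      exact hn (hA.1 _ h')
    rcases hc.eq_or_lt with h2 | h2
    · rw [h2] at hn; exact hn h
    · have h3 : ν (Nat.find hex) ≤ ν k :=
        (hν _ hm).2.trans ((D.mono (Nat.succ_le_of_lt h2)).trans (hν k hk).1)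
      -- A tag at `a` itself may lie on either side of the cut; if `ν k = a`, both tags equal `a`
      -- and cannot be separated.
      rcases (h1.trans h3).eq_or_lt with h4 | h4
      · have : ν (Nat.find hex) = ν k := le_antisymm h3 (h4 ▸ h1)
        rw [this] at hn
        exact hn h
      · exact hA.2 _ h4 h

lemma sum_ite_mul {A : Time → Prop} [DecidablePred A] {n m : ℕ} (hm : m ≤ n) {ν : ℕ → Time}
    (h : ∀ k < n, A (ν k) ↔ k < m) (c : ℕ → ℝ) :
    ∑ k ∈ Finset.range n, (if A (ν k) then 1 else 0) * c k = ∑ k ∈ Finset.range m, c k := by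
  rw [← Finset.sum_subset (Finset.range_mono hm)]
  · refine Finset.sum_congr rfl fun k hk => ?_
    have hk := Finset.mem_range.1 hk
    rw [if_pos ((h k (hk.trans_le hm)).2 hk), one_mul]
  · intro k hk hk'
    rw [Finset.mem_range] at hk hk'
    rw [if_neg fun hA => hk' ((h k hk).1 hA), zero_mul]

lemma sum_cell_right (R : Time → Time → ℝ) (h0 : ∀ s, R s 0 = 0) (D D' : Partition) (k m : ℕ) :
    ∑ l ∈ Finset.range m, cell R D D' k l = R (D.pt (k + 1)) (D'.pt m) - R (D.pt k) (D'.pt m) := by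
  have e : ∀ l, cell R D D' k l = (R (D.pt (k + 1)) (D'.pt (l + 1)) - R (D.pt k) (D'.pt (l + 1))) -
      (R (D.pt (k + 1)) (D'.pt l) - R (D.pt k) (D'.pt l)) := by
    intro l
    simp only [cell, rect]
    ring
  rw [Finset.sum_congr rfl fun l _ => e l,
    Finset.sum_range_sub (fun l => R (D.pt (k + 1)) (D'.pt l) - R (D.pt k) (D'.pt l)),
    D'.first, h0, h0]
  simp

/-- The integral of the indicator function of a rectangle. -/
lemma hasRSIntegral_ite_mul_ite {R : Time → Time → ℝ} (hR : Continuous fun x : Time × Time => R x.1 x.2)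
    (h0 : ∀ s, R s 0 = 0) (h0' : ∀ s, R 0 s = 0) {A B : Time → Prop} [DecidablePred A]
    [DecidablePred B] {a b : Time} (hA : IsCut A a) (hB : IsCut B b) :
    HasRSIntegral (fun s t => (if A s then 1 else 0) * (if B t then 1 else 0)) R (R a b) := by
  intro ε hε
  -- The Riemann sum telescopes exactly to the value of `R` at a grid point close to `(a,b)`, so
  -- continuity there is all that is needed.
  obtain ⟨δ, hδ, hc⟩ := Metric.continuousAt_iff.1 (hR.continuousAt (x := (a, b))) ε hε
  refine ⟨δ, hδ, fun D D' hD hD' ν μ hν hμ => ?_⟩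
  obtain ⟨m, hm, hma, hmA⟩ := hA.exists_index hδ hD hν
  obtain ⟨m', hm', hmb, hmB⟩ := hB.exists_index hδ hD' hμ
  simp only [mul_assoc, ← Finset.mul_sum]
  have e : ∀ k, ∑ l ∈ Finset.range D'.n, (if B (μ l) then 1 else 0) * cell R D D' k l =
      R (D.pt (k + 1)) (D'.pt m') - R (D.pt k) (D'.pt m') := fun k => by
    rw [sum_ite_mul hm' hmB, sum_cell_right R h0]
  simp only [e]
  rw [sum_ite_mul hm hmA, Finset.sum_range_sub (fun k => R (D.pt k) (D'.pt m')), D.first, h0',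
    sub_zero]
  refine hc (x := (D.pt m, D'.pt m')) ?_
  rw [Prod.dist_eq, Subtype.dist_eq, Subtype.dist_eq, Real.dist_eq, Real.dist_eq]
  exact max_lt hma hmb

/-- Integration of a product against the covariance function, for an indicator function as the
second factor. -/
lemma hasRSIntegral_mul_ite {a : ℝ} (ha : 0 < a) (ha2 : a ≤ 2) {Φ : Time → ℝ} (hΦ : Continuous Φ)
    {b : Time} {w : ℝ} (hw : HasRSIntegral₁ Φ (fun t => fbmCov a t b) w) {B : Time → Prop}
    [DecidablePred B] (hB : IsCut B b) :
    HasRSIntegral (fun u v => Φ u * (if B v then 1 else 0)) (fbmCov a) w := by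
  obtain ⟨M, hM⟩ : ∃ M, ∀ u, |Φ u| ≤ M := by
    obtain ⟨M, hM⟩ := isCompact_univ.exists_bound_of_continuousOn hΦ.continuousOn
    exact ⟨M, fun u => hM u trivial⟩
  have hM0 : 0 ≤ M := (abs_nonneg _).trans (hM 0)
  intro ε hε
  obtain ⟨δ, hδ, h1⟩ := hw (ε / 2) (half_pos hε)
  have hq : 0 < min 1 a := lt_min one_pos ha
  have hcont : Filter.Tendsto (fun x : ℝ => M * (2 * |x| ^ min 1 a)) (nhds 0) (nhds 0) := by
    have : Continuous fun x : ℝ => M * (2 * |x| ^ min 1 a) := by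
      have := hq.le
      fun_prop (disch := assumption)
    convert! this.tendsto 0 using 2
    simp [Real.zero_rpow hq.ne']
  obtain ⟨δ', hδ', h2⟩ := Metric.tendsto_nhds_nhds.1 hcont (ε / 2) (half_pos hε)
  refine ⟨min δ δ', lt_min hδ hδ', fun D D' hD hD' ν μ hν hμ => ?_⟩
  obtain ⟨m', hm', hmb, hmB⟩ := hB.exists_index hδ' (hD'.mono (min_le_right _ _)) hμ
  simp only [mul_assoc, ← Finset.mul_sum]
  -- Replacing the grid point `D'.pt m'` by `b` leaves a thin strip, whose increments have total
  -- variation at most `2 |D'.pt m' - b|^(min 1 a)`.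
  have e : ∀ k, ∑ l ∈ Finset.range D'.n, (if B (μ l) then 1 else 0) * cell (fbmCov a) D D' k l =
      (fbmCov a (D.pt (k + 1)) b - fbmCov a (D.pt k) b) +
        rect (fbmCov a) (D.pt k) (D.pt (k + 1)) b (D'.pt m') := fun k => by
    rw [sum_ite_mul hm' hmB, sum_cell_right _ (fbmCov_zero_right ha)]
    unfold rect
    ring
  simp only [e, mul_add, Finset.sum_add_distrib]
  have e1 := h1 D (hD.mono (min_le_left _ _)) ν hν
  have e2 : |∑ k ∈ Finset.range D.n, Φ (ν k) * rect (fbmCov a) (D.pt k) (D.pt (k + 1)) b (D'.pt m')|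
      < ε / 2 := by
    have h3 := h2 (x := (D'.pt m' : ℝ) - b) (by simpa using hmb)
    rw [Real.dist_eq, sub_zero] at h3
    refine lt_of_le_of_lt ?_ ((le_abs_self _).trans_lt h3)
    refine le_trans ?_ (mul_le_mul_of_nonneg_left (sum_abs_rect_fbmCov_le ha ha2 D b (D'.pt m')) hM0)
    rw [Finset.mul_sum]
    refine (Finset.abs_sum_le_sum_abs _ _).trans (Finset.sum_le_sum fun k _ => ?_)
    rw [abs_mul]
    exact mul_le_mul_of_nonneg_right (hM _) (abs_nonneg _)
  rw [add_sub_right_comm]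
  exact (abs_add_le _ _).trans_lt (by linarith)

/-! ### Iterated integrals of the Lévy kernel -/

lemma levyKernel_self (i : Fin 2) : levyKernel i i = fun _ _ => 0 := by
  funext s t
  fin_cases i <;> simp [levyKernel]

lemma levyKernel_one_zero : levyKernel 1 0 = fun s t => -levyKernel 0 1 s t := by
  funext s t
  simp only [levyKernel]
  norm_num
  ring

/-- Averaging the strict and the weak indicator gives the right value on the diagonal, and as a
function of `s` each term is the indicator of a cut. -/
lemma levyKernel_zero_one (s u : Time) : levyKernel 0 1 s u =
    ((if s < u then 1 else 0) + (if s ≤ u then 1 else 0) - (if s ≤ 1 then 1 else 0)) / 2 := by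
  have h1 : s ≤ 1 := s.2.2
  simp only [levyKernel, h1]
  norm_num
  rcases lt_trichotomy s u with h | h | h
  · simp [h, h.le, not_lt.2 h.le]
  · simp [h]
  · simp [h, not_lt.2 h.le, not_le.2 h]

lemma ite_and_le (τ x : Time) : (if 0 < x ∧ x ≤ τ then (1 : ℝ) else 0) =
    (if x ≤ τ then 1 else 0) - (if x ≤ 0 then 1 else 0) := by
  have h0 : (0 : Time) ≤ τ := τ.2.1
  rcases lt_or_ge 0 x with h | h
  · simp [h, not_le.2 h]
  · simp [h, not_lt.2 h, h.trans h0]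

/-- The iterated integral of the Lévy kernel against a product of generators. -/
theorem hasQuadIntegral_levyKernel {a a' : ℝ} (ha : 0 < a) (ha' : 0 < a') (ha2' : a' ≤ 2)
    (τ σ : Time) {w : ℝ}
    (hw : HasRSIntegral₁ (fun u => fbmCov a u τ - fbmCov a 1 τ / 2) (fun u => fbmCov a' u σ) w) :
    HasQuadIntegral (levyKernel 0 1)
      (fun t v => (if 0 < t ∧ t ≤ τ then 1 else 0) * (if 0 < v ∧ v ≤ σ then 1 else 0))
      (fbmCov a) (fbmCov a') w := by
  refine ⟨fun u v => (fbmCov a u τ - fbmCov a 1 τ / 2) * (if 0 < v ∧ v ≤ σ then 1 else 0),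
    fun u v => ?_, ?_⟩
  · have r := fun {A B : Time → Prop} [DecidablePred A] [DecidablePred B] {x y : Time}
      (hA : IsCut A x) (hB : IsCut B y) => hasRSIntegral_ite_mul_ite (continuous_fbmCov ha)
        (fbmCov_zero_right ha) (fbmCov_zero_left ha) hA hB
    -- The cuts at `u` contribute `R(u,y)` twice and the cut at 1 contributes `R(1,y)`; the cut `y =
    -- 0`, needed to produce `𝟙_{(0,τ]}`, contributes nothing.
    have q := fun (y : Time) => ((r (isCut_lt u) (isCut_le y)).add (r (isCut_le u) (isCut_le y))).sub
      (r (isCut_le 1) (isCut_le y))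
    have := ((q τ).sub (q 0)).const_mul ((if 0 < v ∧ v ≤ σ then 1 else 0) / 2)
    convert! this using 1
    · funext s t
      beta_reduce
      rw [levyKernel_zero_one, ite_and_le τ t]
      ring
    · simp only [fbmCov_zero_right ha]
      ring
  · have h0 : HasRSIntegral₁ (fun u => fbmCov a u τ - fbmCov a 1 τ / 2)
        (fun u => fbmCov a' u 0) 0 := by
      simp only [fbmCov_zero_right ha']
      exact HasRSIntegral₁.const _ _
    have := (hasRSIntegral_mul_ite ha' ha2' (continuous_fbmCov_left ha τ) hw (isCut_le σ)).sub
      (hasRSIntegral_mul_ite ha' ha2' (continuous_fbmCov_left ha τ) h0 (isCut_le 0))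
    convert! this using 1
    · funext u v
      rw [ite_and_le σ v]
      ring
    · ring

/-! ### Uniform bounds for the approximations of the Lévy kernel -/

/-- One bound is Bernoulli's inequality at `x` and `-x`, where the linear terms cancel. The other
applies it to an exponent in `[0,1]` differing from `a` by reflection or by one, which leaves a
quadratic error. -/
lemma abs_second_difference_le_aux {a x : ℝ} (ha : 0 < a) (ha2 : a ≤ 2) (hx : 0 ≤ x) (hx1 : x ≤ 1) :
    |(1 + x) ^ a + (1 - x) ^ a - 2| ≤ 2 * x ^ 2 := by
  rw [abs_le]
  rcases le_total a 1 with h | h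
  · have u1 := rpow_one_add_le_one_add_mul_self (s := x) (by linarith) ha.le h
    have u2 := rpow_one_add_le_one_add_mul_self (s := -x) (by linarith) ha.le h
    rw [← sub_eq_add_neg] at u2
    refine ⟨?_, by nlinarith⟩
    -- From `(1 ± x)^a = (1 ± x) / (1 ± x)^b` and Bernoulli in the denominators, the sum is at least
    -- `(2 - 2bx²) / (1 - b²x²) ≥ 2 - 2bx²` when `bx < 1`.
    set b := 1 - a with hb
    have hb0 : 0 ≤ b := by linarith
    have hb1 : b < 1 := by linarith
    have v1 := rpow_one_add_le_one_add_mul_self (s := x) (by linarith) hb0 hb1.le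
    have v2 := rpow_one_add_le_one_add_mul_self (s := -x) (by linarith) hb0 hb1.le
    rw [← sub_eq_add_neg] at v2
    have e1 : (1 + x) ^ a * (1 + x) ^ b = 1 + x := by
      rw [← Real.rpow_add' (by linarith) (by simp [hb])]; simp [hb]
    have e2 : (1 - x) ^ a * (1 - x) ^ b = 1 - x := by
      rw [← Real.rpow_add' (by linarith) (by simp [hb])]; simp [hb]
    have hbx : b * x < 1 := by nlinarith
    have hbx0 : 0 ≤ b * x := mul_nonneg hb0 hx
    have f1 : (1 + x) / (1 + b * x) ≤ (1 + x) ^ a := by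
      rw [div_le_iff₀ (by linarith)]
      calc 1 + x = (1 + x) ^ a * (1 + x) ^ b := e1.symm
        _ ≤ _ := mul_le_mul_of_nonneg_left v1 (Real.rpow_nonneg (by linarith) _)
    have f2 : (1 - x) / (1 - b * x) ≤ (1 - x) ^ a := by
      rw [div_le_iff₀ (by linarith)]
      calc 1 - x = (1 - x) ^ a * (1 - x) ^ b := e2.symm
        _ ≤ (1 - x) ^ a * (1 - b * x) :=
          mul_le_mul_of_nonneg_left (by linarith) (Real.rpow_nonneg (by linarith) _)
    have hx2 : b * x ^ 2 ≤ x ^ 2 := by nlinarith [sq_nonneg x]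
    have hx3 : b * x ^ 2 ≤ 1 := by nlinarith [sq_nonneg x]
    have f3 : 2 - 2 * b * x ^ 2 ≤ (1 + x) / (1 + b * x) + (1 - x) / (1 - b * x) := by
      rw [div_add_div _ _ (by linarith) (by linarith), le_div_iff₀ (by nlinarith)]
      have : 0 ≤ (2 - 2 * b * x ^ 2) * (b * x) ^ 2 :=
        mul_nonneg (by linarith) (sq_nonneg _)
      nlinarith
    linarith
  · have u1 := one_add_mul_self_le_rpow_one_add (s := x) (by linarith) h
    have u2 := one_add_mul_self_le_rpow_one_add (s := -x) (by linarith) h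
    rw [← sub_eq_add_neg] at u2
    refine ⟨by nlinarith [sq_nonneg x], ?_⟩
    -- Here `(1 ± x)^a ≤ (1 ± x)(1 ± cx)`, and the products sum to `2 + 2cx²`.
    set c := a - 1 with hc
    have hc0 : 0 ≤ c := by linarith
    have hc1 : c ≤ 1 := by linarith
    have v1 := rpow_one_add_le_one_add_mul_self (s := x) (by linarith) hc0 hc1
    have v2 := rpow_one_add_le_one_add_mul_self (s := -x) (by linarith) hc0 hc1
    rw [← sub_eq_add_neg] at v2
    have e1 : (1 + x) ^ a = (1 + x) * (1 + x) ^ c := by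
      rw [← Real.rpow_one_add' (by linarith) (by simp [hc]; linarith)]; simp [hc]
    have e2 : (1 - x) ^ a = (1 - x) * (1 - x) ^ c := by
      rw [← Real.rpow_one_add' (by linarith) (by simp [hc]; linarith)]; simp [hc]
    have f1 := mul_le_mul_of_nonneg_left v1 (show 0 ≤ 1 + x by linarith)
    have f2 := mul_le_mul_of_nonneg_left v2 (show 0 ≤ 1 - x by linarith)
    rw [e1, e2]
    nlinarith [sq_nonneg x]

/-- The second difference of the power function. -/
lemma abs_second_difference_le {a m : ℝ} (ha : 0 < a) (ha2 : a ≤ 2) (hm : 1 ≤ m) :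
    |(m + 1) ^ a + (m - 1) ^ a - 2 * m ^ a| ≤ 2 * m ^ (a - 2) := by
  have h0 : 0 < m := by linarith
  have hx1 : m⁻¹ ≤ 1 := inv_le_one_of_one_le₀ hm
  have e1 : (m + 1) ^ a = m ^ a * (1 + m⁻¹) ^ a := by
    rw [← Real.mul_rpow h0.le (by positivity), mul_add, mul_inv_cancel₀ h0.ne', mul_one]
  have e2 : (m - 1) ^ a = m ^ a * (1 - m⁻¹) ^ a := by
    rw [← Real.mul_rpow h0.le (by linarith), mul_sub, mul_inv_cancel₀ h0.ne', mul_one]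
  have e3 : m ^ (a - 2) = m ^ a * m⁻¹ ^ 2 := by
    rw [Real.rpow_sub h0, Real.rpow_two, inv_pow, div_eq_mul_inv]
  rw [e1, e2, e3, show m ^ a * (1 + m⁻¹) ^ a + m ^ a * (1 - m⁻¹) ^ a - 2 * m ^ a =
    m ^ a * ((1 + m⁻¹) ^ a + (1 - m⁻¹) ^ a - 2) by ring, abs_mul,
    abs_of_nonneg (Real.rpow_nonneg h0.le a)]
  have := mul_le_mul_of_nonneg_left (abs_second_difference_le_aux ha ha2
    (x := m⁻¹) (by positivity) hx1) (Real.rpow_nonneg h0.le a)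
  linarith

/-- Sums of powers with exponent greater than `-1`. -/
lemma sum_rpow_le {c : ℝ} (hc : 0 < c) (n : ℕ) :
    ∑ j ∈ Finset.range n, ((j : ℝ) + 1) ^ (c - 1) ≤ (1 + 1 / c) * (n : ℝ) ^ c := by
  have hn : (0 : ℝ) ≤ (n : ℝ) ^ c := by positivity
  have hc' : 0 < 1 / c := by positivity
  rcases le_total c 1 with h | h
  -- Comparison with the integral of a decreasing function, obtained from Bernoulli's inequality for
  -- `(1 - 1/(j+1))^c`; the bound telescopes.
  · have term : ∀ j ∈ Finset.range n, ((j : ℝ) + 1) ^ (c - 1) ≤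
        1 / c * (((j + 1 : ℕ) : ℝ) ^ c - (j : ℝ) ^ c) := by
      intro j _
      have hj : (0 : ℝ) < j + 1 := by positivity
      have hb := rpow_one_add_le_one_add_mul_self (s := -(1 / ((j : ℝ) + 1)))
        (by rw [neg_le_neg_iff, div_le_one hj]; linarith [(Nat.cast_nonneg j : (0 : ℝ) ≤ j)]) hc.le h
      have e : 1 + -(1 / ((j : ℝ) + 1)) = j / (j + 1) := by field_simp; ring
      rw [e, Real.div_rpow (by positivity) hj.le, div_le_iff₀ (by positivity)] at hb
      have e2 : ((j : ℝ) + 1) ^ c = ((j : ℝ) + 1) ^ (c - 1) * (j + 1) := by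
        rw [Real.rpow_sub_one hj.ne']; field_simp
      have e3 : (1 + c * -(1 / ((j : ℝ) + 1))) * ((j : ℝ) + 1) ^ c =
          ((j : ℝ) + 1) ^ c - c * ((j : ℝ) + 1) ^ (c - 1) := by
        rw [e2]; field_simp; ring
      rw [e3] at hb
      push_cast
      rw [one_div_mul_eq_div, le_div_iff₀ hc]
      linarith
    refine (Finset.sum_le_sum term).trans ?_
    rw [← Finset.mul_sum, Finset.sum_range_sub (fun j : ℕ => (j : ℝ) ^ c)]
    simp only [Nat.cast_zero, Real.zero_rpow hc.ne', sub_zero]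
    linarith
  · have term : ∀ j ∈ Finset.range n, ((j : ℝ) + 1) ^ (c - 1) ≤ (n : ℝ) ^ (c - 1) := by
      intro j hj
      refine Real.rpow_le_rpow (by positivity) ?_ (by linarith)
      exact_mod_cast Finset.mem_range.1 hj
    refine (Finset.sum_le_sum term).trans ?_
    rw [Finset.sum_const, Finset.card_range, nsmul_eq_mul,
      ← Real.rpow_one_add' (by positivity) (by linarith)]
    rw [show 1 + (c - 1) = c by ring]
    nlinarith

lemma sum_abs_sub_rpow_le {c : ℝ} (hc : 0 < c) {n k : ℕ} (hk : k < n) :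
    ∑ l ∈ Finset.range n, (if l = k then 0 else |(k : ℝ) - l| ^ (c - 1)) ≤
      2 * ((1 + 1 / c) * (n : ℝ) ^ c) := by
  rw [← Finset.sum_range_add_sum_Ico _ hk, Finset.sum_range_succ, if_pos rfl, add_zero,
    Finset.sum_Ico_eq_sum_range]
  have mono : ∀ m ≤ n, ∑ j ∈ Finset.range m, ((j : ℝ) + 1) ^ (c - 1) ≤
      (1 + 1 / c) * (n : ℝ) ^ c := fun m hm =>
    (Finset.sum_le_sum_of_subset_of_nonneg (Finset.range_mono hm)
      fun _ _ _ => by positivity).trans (sum_rpow_le hc n)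
  have h1 : ∑ l ∈ Finset.range k, (if l = k then 0 else |(k : ℝ) - l| ^ (c - 1)) =
      ∑ j ∈ Finset.range k, ((j : ℝ) + 1) ^ (c - 1) := by
    rw [← Finset.sum_range_reflect]
    refine Finset.sum_congr rfl fun j hj => ?_
    have hj := Finset.mem_range.1 hj
    rw [if_neg (by omega), Nat.cast_sub (by omega), Nat.cast_sub (by omega)]
    congr 1
    push_cast
    rw [abs_of_nonneg] <;> linarith
  have h2 : ∑ j ∈ Finset.range (n - (k + 1)), (if k + 1 + j = k then 0 else
      |(k : ℝ) - ((k + 1 + j : ℕ) : ℝ)| ^ (c - 1)) =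
      ∑ j ∈ Finset.range (n - (k + 1)), ((j : ℝ) + 1) ^ (c - 1) := by
    refine Finset.sum_congr rfl fun j _ => ?_
    rw [if_neg (by omega)]
    congr 1
    push_cast
    rw [abs_sub_comm, abs_of_nonneg] <;> linarith [(Nat.cast_nonneg j : (0 : ℝ) ≤ j)]
  have h1' := h1.trans_le (mono k hk.le)
  have h2' := h2.trans_le (mono (n - (k + 1)) (Nat.sub_le _ _))
  linarith

lemma cell_symm (a : ℝ) (D : Partition) (k l : ℕ) :
    cell (fbmCov a) D D k l = cell (fbmCov a) D D l k :=
  rect_flip (fbmCov_symm a) _ _ _ _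

/-- The increment is half a second difference of `|·|^a` with step `1/(N+1)`; scaling extracts
`(N+1)^(-a)` and leaves an integer distance `|k-l| ≥ 1`. -/
lemma abs_cell_uniform_le {a : ℝ} (ha : 0 < a) (ha2 : a ≤ 2) {N k l : ℕ} (hk : k < N + 1)
    (hl : l < N + 1) (hkl : l ≠ k) :
    |cell (fbmCov a) (uniform N) (uniform N) k l| ≤
      (N + 1 : ℝ)⁻¹ ^ a * |(k : ℝ) - l| ^ (a - 2) := by
  wlog h : l < k generalizing k l
  · rw [cell_symm, abs_sub_comm]
    exact this hl hk hkl.symm (by omega)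
  set n : ℝ := N + 1 with hn
  have hn0 : 0 < n := by positivity
  set m : ℝ := (k : ℝ) - l with hm
  have hm1 : 1 ≤ m := by
    have : (l : ℝ) + 1 ≤ k := by exact_mod_cast h
    linarith
  rw [cell, rect_fbmCov, coe_uniform_pt hk.le, coe_uniform_pt hl.le,
    coe_uniform_pt (Nat.succ_le_of_lt hk), coe_uniform_pt (Nat.succ_le_of_lt hl), ← hn]
  have e : ∀ x y z : ℝ, 0 ≤ z → x - y = z → |x / n - y / n| ^ a = n⁻¹ ^ a * z ^ a := by
    intro x y z hz hxy
    rw [← sub_div, hxy, abs_of_nonneg (by positivity), div_eq_inv_mul,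
      Real.mul_rpow (by positivity) hz]
  push_cast
  rw [e _ _ (m + 1) (by linarith) (by rw [hm]; ring), e _ _ m (by linarith) (by rw [hm]; ring),
    e _ _ m (by linarith) (by rw [hm]), e _ _ (m - 1) (by linarith) (by rw [hm]; ring),
    show (n⁻¹ ^ a * (m + 1) ^ a - n⁻¹ ^ a * m ^ a - (n⁻¹ ^ a * m ^ a - n⁻¹ ^ a * (m - 1) ^ a)) / 2
      = n⁻¹ ^ a * (((m + 1) ^ a + (m - 1) ^ a - 2 * m ^ a) / 2) by ring, abs_mul,
    abs_of_nonneg (by positivity : 0 ≤ n⁻¹ ^ a), abs_of_nonneg (by linarith : 0 ≤ m), abs_div,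
    abs_two]
  refine mul_le_mul_of_nonneg_left ?_ (by positivity)
  linarith [abs_second_difference_le ha ha2 hm1]

/-- The sums `∑ R(u_k,u_l) □R'(k,l)` along uniform partitions are bounded. -/
theorem exists_sum_fbmCov_mul_cell_le {a a' : ℝ} (ha : 0 < a) (ha' : 0 < a')
    (ha2' : a' ≤ 2) (h : 1 < a + a') :
    ∃ C, ∀ N, ∑ k ∈ Finset.range (N + 1), ∑ l ∈ Finset.range (N + 1),
      fbmCov a ((uniform N).pt k) ((uniform N).pt l) *
        cell (fbmCov a') (uniform N) (uniform N) k l ≤ C := by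
  set c := a + a' - 1 with hc
  have hc0 : 0 < c := by linarith
  refine ⟨2 + (1 + 1 / c), fun N => ?_⟩
  set n : ℝ := N + 1 with hn
  have hn0 : 0 < n := by positivity
  set u : ℕ → Time := (uniform N).pt with hu
  set S := fun k l => cell (fbmCov a') (uniform N) (uniform N) k l with hS
  -- The factor does not depend on `l`, so each row telescopes to an increment of `R'(·,1)`, and
  -- only its one-dimensional variation matters.
  have t1 : ∑ k ∈ Finset.range (N + 1), ∑ l ∈ Finset.range (N + 1), (u k : ℝ) ^ a * S k l ≤ 2 := by
    have row : ∀ k ∈ Finset.range (N + 1), ∑ l ∈ Finset.range (N + 1), (u k : ℝ) ^ a * S k l ≤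
        |rect (fbmCov a') (u k) (u (k + 1)) 0 1| := by
      intro k _
      rw [← Finset.mul_sum, sum_cell_right _ (fbmCov_zero_right ha')]
      have e : rect (fbmCov a') (u k) (u (k + 1)) 0 1 = fbmCov a' (u (k + 1)) 1 -
          fbmCov a' (u k) 1 := by
        simp [rect, fbmCov_zero_right ha']
      have e1 : (uniform N).pt (N + 1) = 1 := (uniform N).last
      rw [e1, ← e]
      have b1 : (u k : ℝ) ^ a ≤ 1 := Real.rpow_le_one (u k).2.1 (u k).2.2 ha.le
      have b0 : 0 ≤ (u k : ℝ) ^ a := Real.rpow_nonneg (u k).2.1 a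
      calc _ ≤ (u k : ℝ) ^ a * |rect (fbmCov a') (u k) (u (k + 1)) 0 1| :=
            mul_le_mul_of_nonneg_left (le_abs_self _) b0
        _ ≤ 1 * |rect (fbmCov a') (u k) (u (k + 1)) 0 1| :=
            mul_le_mul_of_nonneg_right b1 (abs_nonneg _)
        _ = _ := one_mul _
    refine (Finset.sum_le_sum row).trans ?_
    refine (sum_abs_rect_fbmCov_le ha' ha2' (uniform N) 0 1).trans_eq ?_
    simp
  have t2 : ∑ k ∈ Finset.range (N + 1), ∑ l ∈ Finset.range (N + 1), (u l : ℝ) ^ a * S k l ≤ 2 := by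
    rw [Finset.sum_comm]
    refine le_of_eq_of_le ?_ t1
    refine Finset.sum_congr rfl fun k _ => Finset.sum_congr rfl fun l _ => ?_
    simp only [hS]
    rw [cell_symm]
  have t3 : ∑ k ∈ Finset.range (N + 1), ∑ l ∈ Finset.range (N + 1),
      -- The factor `|uₖ-uₗ|^a` kills the diagonal. Off it the terms are at most `n^(-c-1)
      -- |k-l|^(c-1)`; each of the `n` rows sums to order `n^c` because `c > 0`, so the powers of
      -- `n` cancel.
      -(|(u k : ℝ) - u l| ^ a * S k l) ≤ 2 * (1 + 1 / c) := by
    have term : ∀ k ∈ Finset.range (N + 1), ∀ l ∈ Finset.range (N + 1),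
        -(|(u k : ℝ) - u l| ^ a * S k l) ≤
          n⁻¹ ^ (c + 1) * (if l = k then 0 else |(k : ℝ) - l| ^ (c - 1)) := by
      intro k hk l hl
      have hk := Finset.mem_range.1 hk
      have hl := Finset.mem_range.1 hl
      split_ifs with hkl
      · rw [hkl, sub_self, abs_zero, Real.zero_rpow ha.ne']
        simp
      · have hpos : 0 < |(k : ℝ) - l| := by
          rw [abs_pos, sub_ne_zero]
          exact_mod_cast Ne.symm hkl
        have b := abs_cell_uniform_le ha' ha2' hk hl hkl
        have e1 : |(u k : ℝ) - u l| ^ a = n⁻¹ ^ a * |(k : ℝ) - l| ^ a := by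
          rw [hu, coe_uniform_pt hk.le, coe_uniform_pt hl.le, ← hn, ← sub_div, div_eq_inv_mul,
            abs_mul, abs_of_nonneg (by positivity : 0 ≤ n⁻¹),
            Real.mul_rpow (by positivity) (abs_nonneg _)]
        calc -(|(u k : ℝ) - u l| ^ a * S k l) ≤ |(u k : ℝ) - u l| ^ a * |S k l| := by
              rw [← mul_neg]
              exact mul_le_mul_of_nonneg_left (neg_le_abs _) (by positivity)
          _ ≤ (n⁻¹ ^ a * |(k : ℝ) - l| ^ a) * (n⁻¹ ^ a' * |(k : ℝ) - l| ^ (a' - 2)) := by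
              rw [e1]
              exact mul_le_mul_of_nonneg_left b (by positivity)
          _ = (n⁻¹ ^ a * n⁻¹ ^ a') * (|(k : ℝ) - l| ^ a * |(k : ℝ) - l| ^ (a' - 2)) := by ring
          _ = _ := by
              rw [← Real.rpow_add (by positivity), ← Real.rpow_add hpos]
              congr 2 <;> rw [hc] <;> ring
    refine (Finset.sum_le_sum fun k hk => Finset.sum_le_sum fun l hl => term k hk l hl).trans ?_
    simp only [← Finset.mul_sum]
    have row : ∀ k ∈ Finset.range (N + 1), ∑ l ∈ Finset.range (N + 1),
        (if l = k then 0 else |(k : ℝ) - l| ^ (c - 1)) ≤ 2 * ((1 + 1 / c) * n ^ c) := by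
      intro k hk
      have := sum_abs_sub_rpow_le hc0 (Finset.mem_range.1 hk)
      push_cast at this
      exact this
    refine (mul_le_mul_of_nonneg_left (Finset.sum_le_sum row) (by positivity)).trans_eq ?_
    rw [Finset.sum_const, Finset.card_range, nsmul_eq_mul]
    push_cast
    rw [← hn, Real.inv_rpow hn0.le, Real.rpow_add_one hn0.ne']
    have : n ^ c ≠ 0 := (Real.rpow_pos_of_pos hn0 c).ne'
    field_simp
  have split : ∑ k ∈ Finset.range (N + 1), ∑ l ∈ Finset.range (N + 1), fbmCov a (u k) (u l) * S k l =
      (∑ k ∈ Finset.range (N + 1), ∑ l ∈ Finset.range (N + 1), (u k : ℝ) ^ a * S k l +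
      ∑ k ∈ Finset.range (N + 1), ∑ l ∈ Finset.range (N + 1), (u l : ℝ) ^ a * S k l +
      ∑ k ∈ Finset.range (N + 1), ∑ l ∈ Finset.range (N + 1), -(|(u k : ℝ) - u l| ^ a * S k l)) / 2 := by
    simp only [← Finset.sum_add_distrib, Finset.sum_div]
    refine Finset.sum_congr rfl fun k _ => Finset.sum_congr rfl fun l _ => ?_
    unfold fbmCov
    ring
  rw [split]
  linarith

open Filter Topology

/-! ### Representation of the Lévy kernel -/

/-- A bounded sequence in a closed subspace of a Hilbert space has a weak limit point there. -/
lemma exists_weak_limit {E : Type*} [NormedAddCommGroup E] [InnerProductSpace ℝ E] [CompleteSpace E]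
    {K : Submodule ℝ E} (hK : IsClosed (K : Set E)) {f : ℕ → E} (hf : ∀ N, f N ∈ K) {C : ℝ}
    (hC : ∀ N, ‖f N‖ ≤ C) :
    ∃ g ∈ K, ∀ x l, Tendsto (fun N => ⟪f N, x⟫_ℝ) atTop (𝓝 l) → ⟪g, x⟫_ℝ = l := by
  let φ : ℕ → WeakDual ℝ E := fun N => StrongDual.toWeakDual (innerSL ℝ (f N))
  -- Banach–Alaoglu along an ultrafilter finer than `atTop`: all pairings converge, and those
  -- already convergent along `atTop` keep their limits. No separability is required.
  obtain ⟨L, -, hL⟩ := (WeakDual.isCompact_closedBall (𝕜 := ℝ) (E := E) 0 C).ultrafilter_le_nhds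
    ((Ultrafilter.of (atTop : Filter ℕ)).map φ) (by
      rw [le_principal_iff]
      refine Filter.mem_map.2 (Filter.univ_mem' fun N => ?_)
      change innerSL ℝ (f N) ∈ Metric.closedBall (0 : StrongDual ℝ E) C
      rw [mem_closedBall_zero_iff, innerSL_apply_norm]
      exact hC N)
  have hL' : Tendsto φ (Ultrafilter.of (atTop : Filter ℕ) : Filter ℕ) (𝓝 L) := hL
  set g : E := (InnerProductSpace.toDual ℝ E).symm (WeakDual.toStrongDual L) with hg
  have hgL : ∀ x, ⟪g, x⟫_ℝ = L x := fun x => by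
    rw [hg, InnerProductSpace.toDual_symm_apply]
    rfl
  have lim : ∀ x, Tendsto (fun N => ⟪f N, x⟫_ℝ) (Ultrafilter.of (atTop : Filter ℕ) : Filter ℕ)
      (𝓝 ⟪g, x⟫_ℝ) := fun x => by
    rw [hgL]
    exact ((WeakDual.eval_continuous x).tendsto L).comp hL'
  refine ⟨g, ?_, fun x l hl => tendsto_nhds_unique (lim x) (hl.mono_left (Ultrafilter.of_le _))⟩
  -- Pairings with `Kᗮ` vanish along the sequence, hence in the limit; for closed `K` the double
  -- orthogonal complement is `K`.
  have h1 : g ∈ Kᗮᗮ := by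
    rw [Submodule.mem_orthogonal']
    intro x hx
    refine tendsto_nhds_unique (lim x) ?_
    have : ∀ N, ⟪f N, x⟫_ℝ = 0 := fun N => (Submodule.mem_orthogonal K x).1 hx _ (hf N)
    simp only [this]
    exact tendsto_const_nhds
  rw [Submodule.orthogonal_orthogonal_eq_closure] at h1
  rwa [hK.submodule_topologicalClosure_eq] at h1

variable {R : Fin 2 → CovFun}

lemma inner_tensor (x y z w : Hil R) : ⟪tensor x y, tensor z w⟫_ℝ = ⟪x, z⟫_ℝ * ⟪y, w⟫_ℝ := by
  unfold tensor
  rw [UniformSpace.Completion.inner_coe, TensorProduct.inner_tmul]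

lemma ofStep_add (g g' : Step₂ R ⊗[ℝ] Step₂ R) : ofStep (g + g') = ofStep g + ofStep g' := by
  unfold ofStep
  rw [map_add, UniformSpace.Completion.coe_add]

lemma ofStep_smul (c : ℝ) (g : Step₂ R ⊗[ℝ] Step₂ R) : ofStep (c • g) = c • ofStep g := by
  unfold ofStep
  rw [map_smul, UniformSpace.Completion.coe_smul]

lemma Step₂.evalTensor_add (g g' : Step₂ R ⊗[ℝ] Step₂ R) (i j : Fin 2) :
    evalTensor (g + g') i j = fun x y => evalTensor g i j x y + evalTensor g' i j x y := by
  funext x y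
  simp [evalTensor]

lemma Step₂.evalTensor_smul (c : ℝ) (g : Step₂ R ⊗[ℝ] Step₂ R) (i j : Fin 2) :
    evalTensor (c • g) i j = fun x y => c * evalTensor g i j x y := by
  funext x y
  simp [evalTensor]

lemma Step₂.evalTensor_tmul (f g : Step₂ R) (i j : Fin 2) (x y : Time) :
    evalTensor (f ⊗ₜ[ℝ] g) i j x y = (f.comp i).eval x * (g.comp j).eval y := by
  simp [evalTensor, evalₗ]

variable (R) in
/-- The step function `𝟙_{(0,t]}` in the component `i`. -/
def gen (i : Fin 2) (t : Time) : Step₂ R := Step₂.mk R (Pi.single i (Finsupp.single t 1))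

lemma comp_gen (i j : Fin 2) (t : Time) :
    (gen R i t).comp j = if j = i then Finsupp.single t 1 else 0 := by
  unfold gen Step₂.comp Step₂.mk
  rw [Pi.single_apply]

lemma eval_comp_gen (i j : Fin 2) (t x : Time) :
    ((gen R i t).comp j).eval x = if j = i then (if 0 < x ∧ x ≤ t then 1 else 0) else 0 := by
  rw [comp_gen]
  split_ifs <;> simp_all [Step.eval]

lemma form_single (R : CovFun) (s t : Time) :
    R.form (Finsupp.single s 1) (Finsupp.single t 1) = R.toFun s t := by
  simp [CovFun.form]

lemma form_zero_left (R : CovFun) (φ : Step) : R.form 0 φ = 0 := by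
  simp [CovFun.form]

lemma inner_gen (i j : Fin 2) (s t : Time) :
    ⟪gen R i s, gen R j t⟫_ℝ = if i = j then (R i).toFun s t else 0 := by
  change ∑ k, (R k).form ((gen R i s).comp k) ((gen R j t).comp k) = _
  rw [Finset.sum_eq_single i]
  · rw [comp_gen, comp_gen, if_pos rfl]
    split_ifs
    · exact form_single _ _ _
    · rw [CovFun.form_symm, form_zero_left]
  · intro k _ hk
    rw [comp_gen, if_neg hk, form_zero_left]
  · simp

lemma Step₂.induction {p : Step₂ R → Prop} (zero : p 0) (add : ∀ f g, p f → p g → p (f + g))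
    (smul : ∀ (c : ℝ) (f : Step₂ R), p f → p (c • f)) (h : ∀ i t, p (gen R i t)) (f : Step₂ R) : p f := by
  have key : ∀ (i : Fin 2) (φ : Step), p (Step₂.mk R (Pi.single i φ)) := by
    intro i φ
    induction φ using Finsupp.induction_linear with
    | zero => rw [Pi.single_zero]; exact zero
    | add φ ψ hφ hψ => rw [Pi.single_add]; exact add _ _ hφ hψ
    | single t a =>
      have e : Step₂.mk R (Pi.single i (Finsupp.single t a)) = a • gen R i t := by
        change (Pi.single i (Finsupp.single t a) : Fin 2 → Step) =
          a • (Pi.single i (Finsupp.single t 1) : Fin 2 → Step)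
        rw [← Pi.single_smul]
        simp
      rw [e]
      exact smul _ _ (h i t)
  have e : f = Step₂.mk R (Pi.single 0 (f.comp 0)) + Step₂.mk R (Pi.single 1 (f.comp 1)) := by
    change (f : Fin 2 → Step) = (Pi.single 0 (f.comp 0) + Pi.single 1 (f.comp 1) : Fin 2 → Step)
    funext i
    fin_cases i <;> simp [Step₂.comp]
  rw [e]
  exact add _ _ (key _ _) (key _ _)

/-- The element `𝟙_{(0,t]}` of the Hilbert space, in the component `i`. -/
def hilGen (R : Fin 2 → CovFun) (i : Fin 2) (t : Time) : Hil R := (gen R i t : Hil R)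

lemma inner_hilGen (i j : Fin 2) (s t : Time) :
    ⟪hilGen R i s, hilGen R j t⟫_ℝ = if i = j then (R i).toFun s t else 0 := by
  unfold hilGen
  rw [UniformSpace.Completion.inner_coe, inner_gen]

/-- The integrals against the step tensor `g` exist, and their sum is the limit of the inner
products with the approximations `f`. -/
def Approximates (f : ℕ → HilTensor R) (g : Step₂ R ⊗[ℝ] Step₂ R) : Prop :=
  ∃ w : Fin 2 → Fin 2 → ℝ,
    (∀ i j, HasQuadIntegral (levyKernel i j) (Step₂.evalTensor g i j)
      (R i).toFun (R j).toFun (w i j)) ∧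
    Tendsto (fun N => ⟪f N, ofStep g⟫_ℝ) atTop (𝓝 (∑ i, ∑ j, w i j))

lemma Approximates.add {f : ℕ → HilTensor R} {g g' : Step₂ R ⊗[ℝ] Step₂ R}
    (h : Approximates f g) (h' : Approximates f g') : Approximates f (g + g') := by
  obtain ⟨w, h1, h2⟩ := h
  obtain ⟨w', h1', h2'⟩ := h'
  refine ⟨fun i j => w i j + w' i j, fun i j => ?_, ?_⟩
  · rw [Step₂.evalTensor_add]
    exact (h1 i j).add (h1' i j)
  · simp only [ofStep_add, inner_add_right, Finset.sum_add_distrib]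
    exact h2.add h2'

lemma Approximates.smul {f : ℕ → HilTensor R} {g : Step₂ R ⊗[ℝ] Step₂ R}
    (h : Approximates f g) (c : ℝ) : Approximates f (c • g) := by
  obtain ⟨w, h1, h2⟩ := h
  refine ⟨fun i j => c * w i j, fun i j => ?_, ?_⟩
  · rw [Step₂.evalTensor_smul]
    exact (h1 i j).const_mul c
  · simp only [ofStep_smul, inner_smul_right, ← Finset.mul_sum]
    exact h2.const_mul c

lemma Approximates.of_gen {f : ℕ → HilTensor R}
    (h : ∀ i j τ σ, Approximates f (gen R i τ ⊗ₜ[ℝ] gen R j σ)) (g : Step₂ R ⊗[ℝ] Step₂ R) :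
    Approximates f g := by
  have zero : Approximates f 0 := by simpa using (h 0 0 0 0).smul 0
  induction g with
  | zero => exact zero
  | add g g' h h' => exact h.add h'
  | tmul x y =>
    induction x using Step₂.induction with
    | zero => rw [TensorProduct.zero_tmul]; exact zero
    | add x x' h h' => rw [TensorProduct.add_tmul]; exact h.add h'
    | smul c x h => rw [← TensorProduct.smul_tmul']; exact h.smul c
    | h i τ =>
      induction y using Step₂.induction with
      | zero => rw [TensorProduct.tmul_zero]; exact zero
      | add y y' h h' => rw [TensorProduct.tmul_add]; exact h.add h'
      | smul c y h => rw [TensorProduct.tmul_smul]; exact h.smul c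
      | h j σ => exact h i j τ σ

lemma isClosed_symTensor : IsClosed (symTensor R : Set (HilTensor R)) :=
  Submodule.isClosed_topologicalClosure _

lemma tensor_add_tensor_mem_symTensor (x y : Hil R) : tensor x y + tensor y x ∈ symTensor R :=
  Submodule.le_topologicalClosure _ (Submodule.subset_span ⟨(x, y), rfl⟩)

/-! ### The approximating symmetric tensors -/

/-- The first factors of the approximations of the Lévy kernel. -/
def levyFst (R : Fin 2 → CovFun) (N k : ℕ) : Hil R :=
  hilGen R 0 ((uniform N).pt k) - (1 / 2 : ℝ) • hilGen R 0 1

/-- The second factors of the approximations of the Lévy kernel. -/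
def levySnd (R : Fin 2 → CovFun) (N k : ℕ) : Hil R :=
  hilGen R 1 ((uniform N).pt (k + 1)) - hilGen R 1 ((uniform N).pt k)

/-- The approximation of the Lévy kernel along a uniform partition. -/
def levyApprox (R : Fin 2 → CovFun) (N : ℕ) : HilTensor R :=
  ∑ k ∈ Finset.range (N + 1),
    (tensor (levyFst R N k) (levySnd R N k) + tensor (levySnd R N k) (levyFst R N k))

lemma levyApprox_mem (N : ℕ) : levyApprox R N ∈ symTensor R :=
  Submodule.sum_mem _ fun _ _ => tensor_add_tensor_mem_symTensor _ _

lemma inner_levyApprox (N : ℕ) (x y : Hil R) : ⟪levyApprox R N, tensor x y⟫_ℝ =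
    ∑ k ∈ Finset.range (N + 1), (⟪levyFst R N k, x⟫_ℝ * ⟪levySnd R N k, y⟫_ℝ +
      ⟪levySnd R N k, x⟫_ℝ * ⟪levyFst R N k, y⟫_ℝ) := by
  unfold levyApprox
  simp only [sum_inner, inner_add_left, inner_tensor]

lemma inner_levyFst (N k : ℕ) (t : Time) (i : Fin 2) : ⟪levyFst R N k, hilGen R i t⟫_ℝ =
    if i = 0 then (R 0).toFun ((uniform N).pt k) t - (R 0).toFun 1 t / 2 else 0 := by
  unfold levyFst
  rw [inner_sub_left, inner_smul_left, inner_hilGen, inner_hilGen]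
  fin_cases i <;> simp
  ring

lemma inner_levySnd (N k : ℕ) (t : Time) (i : Fin 2) : ⟪levySnd R N k, hilGen R i t⟫_ℝ =
    if i = 1 then (R 1).toFun ((uniform N).pt (k + 1)) t - (R 1).toFun ((uniform N).pt k) t
      else 0 := by
  unfold levySnd
  rw [inner_sub_left, inner_hilGen, inner_hilGen]
  fin_cases i <;> simp

lemma inner_levySnd_levySnd (N k l : ℕ) :
    ⟪levySnd R N k, levySnd R N l⟫_ℝ = cell (R 1).toFun (uniform N) (uniform N) k l := by
  nth_rw 2 [levySnd]
  rw [inner_sub_right, inner_levySnd, inner_levySnd]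
  simp only [if_true, cell, rect]
  ring

lemma norm_sum_tensor_sq {ι : Type*} (s : Finset ι) (x y : ι → Hil R) :
    ‖∑ k ∈ s, tensor (x k) (y k)‖ ^ 2 =
      ∑ k ∈ s, ∑ l ∈ s, ⟪x k, x l⟫_ℝ * ⟪y k, y l⟫_ℝ := by
  rw [← real_inner_self_eq_norm_sq]
  simp only [sum_inner, inner_sum, inner_tensor]
  exact Finset.sum_comm

lemma tensor_sub_left (x x' y : Hil R) : tensor (x - x') y = tensor x y - tensor x' y := by
  unfold tensor
  rw [TensorProduct.sub_tmul, UniformSpace.Completion.coe_sub]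

lemma sum_cell_uniform {a : ℝ} (ha : 0 < a) (N : ℕ) : ∑ k ∈ Finset.range (N + 1),
    ∑ l ∈ Finset.range (N + 1), cell (fbmCov a) (uniform N) (uniform N) k l = 1 := by
  have e1 : (uniform N).pt (N + 1) = 1 := (uniform N).last
  simp only [sum_cell_right _ (fbmCov_zero_right ha)]
  rw [Finset.sum_range_sub (fun k => fbmCov a ((uniform N).pt k) ((uniform N).pt (N + 1))), e1,
    (uniform N).first, fbmCov_zero_left ha]
  simp [fbmCov, Real.zero_rpow ha.ne']

section Fbm

variable {a a' : ℝ} (ha : 0 < a) (ha2 : a ≤ 2) (ha' : 0 < a') (ha2' : a' ≤ 2)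
  (hR : (R 0).toFun = fbmCov a) (hR' : (R 1).toFun = fbmCov a')

-- The main part is controlled by the uniform bound on `∑ R₁ □R₂`. The correction by `½ 𝟙_{(0,1]}`
-- collapses to one elementary tensor, of squared norm `R₁(1,1) R₂(1,1) / 4 = 1/4`, and
-- symmetrisation doubles the bound.
include ha ha' ha2' hR hR' in
lemma exists_norm_levyApprox_le (h : 1 < a + a') : ∃ C, ∀ N, ‖levyApprox R N‖ ≤ C := by
  obtain ⟨C, hC⟩ := exists_sum_fbmCov_mul_cell_le ha ha' ha2' h
  refine ⟨2 * (√C + √(1 / 4)), fun N => ?_⟩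
  have h1 : ‖∑ k ∈ Finset.range (N + 1), tensor (hilGen R 0 ((uniform N).pt k))
      (levySnd R N k)‖ ≤ √C := by
    refine Real.le_sqrt_of_sq_le ?_
    rw [norm_sum_tensor_sq]
    refine le_of_eq_of_le ?_ (hC N)
    refine Finset.sum_congr rfl fun k _ => Finset.sum_congr rfl fun l _ => ?_
    rw [inner_levySnd_levySnd, inner_hilGen, if_pos rfl, hR, hR']
  have h2 : ‖∑ k ∈ Finset.range (N + 1), tensor ((1 / 2 : ℝ) • hilGen R 0 1)
      (levySnd R N k)‖ ≤ √(1 / 4) := by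
    refine Real.le_sqrt_of_sq_le ?_
    rw [norm_sum_tensor_sq]
    simp only [inner_levySnd_levySnd, inner_smul_left, inner_smul_right, inner_hilGen, if_true,
      ← Finset.mul_sum, hR, hR', sum_cell_uniform ha']
    simp [fbmCov, Real.zero_rpow ha.ne']
    norm_num
  have h3 : ‖∑ k ∈ Finset.range (N + 1), tensor (levyFst R N k) (levySnd R N k)‖ ≤
      √C + √(1 / 4) := by
    have e : ∑ k ∈ Finset.range (N + 1), tensor (levyFst R N k) (levySnd R N k) =
        ∑ k ∈ Finset.range (N + 1), tensor (hilGen R 0 ((uniform N).pt k)) (levySnd R N k) -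
        ∑ k ∈ Finset.range (N + 1), tensor ((1 / 2 : ℝ) • hilGen R 0 1) (levySnd R N k) := by
      rw [← Finset.sum_sub_distrib]
      exact Finset.sum_congr rfl fun k _ => tensor_sub_left _ _ _
    rw [e]
    exact (norm_sub_le _ _).trans (add_le_add h1 h2)
  have h4 : ‖∑ k ∈ Finset.range (N + 1), tensor (levySnd R N k) (levyFst R N k)‖ =
      ‖∑ k ∈ Finset.range (N + 1), tensor (levyFst R N k) (levySnd R N k)‖ := by
    rw [← sq_eq_sq₀ (norm_nonneg _) (norm_nonneg _), norm_sum_tensor_sq, norm_sum_tensor_sq]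
    simp only [mul_comm]
  unfold levyApprox
  rw [Finset.sum_add_distrib]
  refine (norm_add_le _ _).trans ?_
  rw [h4]
  linarith

lemma eventually_meshLT_uniform {δ : ℝ} (hδ : 0 < δ) : ∀ᶠ N in atTop, (uniform N).MeshLT δ := by
  filter_upwards [(tendsto_one_div_add_atTop_nhds_zero_nat (𝕜 := ℝ)).eventually_lt_const hδ]
    with N hN k hk
  have hk : k < N + 1 := hk
  rw [coe_uniform_pt hk.le, coe_uniform_pt (Nat.succ_le_of_lt hk)]
  refine lt_of_eq_of_lt ?_ hN
  push_cast
  field_simp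
  ring

lemma HasRSIntegral₁.tendsto_uniform {Φ Ψ : Time → ℝ} {w : ℝ} (h : HasRSIntegral₁ Φ Ψ w)
    {ν : ℕ → ℕ → Time} (hν : ∀ N, (uniform N).IsTag (ν N)) :
    Tendsto (fun N => ∑ k ∈ Finset.range (N + 1), Φ (ν N k) *
      (Ψ ((uniform N).pt (k + 1)) - Ψ ((uniform N).pt k))) atTop (𝓝 w) := by
  rw [Metric.tendsto_nhds]
  intro ε hε
  obtain ⟨δ, hδ, hd⟩ := h ε hε
  filter_upwards [eventually_meshLT_uniform hδ] with N hN
  exact hd _ hN _ (hν N)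

lemma hasQuadIntegral_zero_of_ne {i j i' j' : Fin 2} (h : ¬ (i' = i ∧ j' = j)) (τ σ : Time)
    (f S S' : Time → Time → ℝ) :
    HasQuadIntegral f (Step₂.evalTensor (gen R i τ ⊗ₜ[ℝ] gen R j σ) i' j') S S' 0 := by
  have e : Step₂.evalTensor (gen R i τ ⊗ₜ[ℝ] gen R j σ) i' j' = fun _ _ => 0 := by
    funext x y
    rw [Step₂.evalTensor_tmul, eval_comp_gen, eval_comp_gen]
    by_cases h1 : i' = i
    · rw [if_neg fun h2 => h ⟨h1, h2⟩, mul_zero]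
    · rw [if_neg h1, zero_mul]
  rw [e]
  exact HasQuadIntegral.zero_right _ _ _

lemma evalTensor_gen_self (i j : Fin 2) (τ σ : Time) :
    Step₂.evalTensor (gen R i τ ⊗ₜ[ℝ] gen R j σ) i j =
      fun t v => (if 0 < t ∧ t ≤ τ then 1 else 0) * (if 0 < v ∧ v ≤ σ then 1 else 0) := by
  funext x y
  rw [Step₂.evalTensor_tmul, eval_comp_gen, eval_comp_gen, if_pos rfl, if_pos rfl]

lemma approximates_of_self {f : ℕ → HilTensor R} {i j : Fin 2} {τ σ : Time} {w : ℝ}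
    (h : HasQuadIntegral (levyKernel i j)
      (fun t v => (if 0 < t ∧ t ≤ τ then 1 else 0) * (if 0 < v ∧ v ≤ σ then 1 else 0))
      (R i).toFun (R j).toFun w)
    (hl : Tendsto (fun N => ⟪f N, tensor (hilGen R i τ) (hilGen R j σ)⟫_ℝ) atTop (𝓝 w)) :
    Approximates f (gen R i τ ⊗ₜ[ℝ] gen R j σ) := by
  refine ⟨fun i' j' => if i' = i ∧ j' = j then w else 0, fun i' j' => ?_, ?_⟩
  · beta_reduce
    split_ifs with hij
    · obtain ⟨rfl, rfl⟩ := hij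
      rw [evalTensor_gen_self]
      exact h
    · exact hasQuadIntegral_zero_of_ne hij _ _ _ _ _
  · have e : ∑ i', ∑ j', (if i' = i ∧ j' = j then w else 0) = w := by
      simp [ite_and]
    rw [e]
    exact hl

-- On products of generators the pairing is a Riemann sum for the outer integral, either directly or
-- after summation by parts.
include ha ha2 ha' ha2' hR hR' in
lemma approximates_levyApprox (g : Step₂ R ⊗[ℝ] Step₂ R) : Approximates (levyApprox R) g := by
  refine Approximates.of_gen (fun i j τ σ => ?_) g
  have same : ∀ i, Approximates (levyApprox R) (gen R i τ ⊗ₜ[ℝ] gen R i σ) := fun i => by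
    refine approximates_of_self (w := 0) ?_ ?_
    · rw [levyKernel_self]
      exact HasQuadIntegral.zero_left _ _ _
    · have : ∀ N, ⟪levyApprox R N, tensor (hilGen R i τ) (hilGen R i σ)⟫_ℝ = 0 := fun N => by
        rw [inner_levyApprox]
        refine Finset.sum_eq_zero fun k _ => ?_
        simp only [inner_levyFst, inner_levySnd]
        fin_cases i <;> simp
      simp only [this]
      exact tendsto_const_nhds
  have h01 : Approximates (levyApprox R) (gen R 0 τ ⊗ₜ[ℝ] gen R 1 σ) := by
    obtain ⟨w, hw⟩ := exists_hasRSIntegral₁_fbmCov (continuous_fbmCov_left ha τ) ha' σ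
    refine approximates_of_self (w := w) ?_ ?_
    · rw [hR, hR']
      exact hasQuadIntegral_levyKernel ha ha' ha2' τ σ hw
    -- The pairing is exactly the Riemann sum with left endpoints as tags.
    · refine (hw.tendsto_uniform (ν := fun N => (uniform N).pt) fun N k _ =>
        ⟨le_rfl, (uniform N).mono (Nat.le_succ k)⟩).congr fun N => ?_
      rw [inner_levyApprox]
      simp only [inner_levyFst, inner_levySnd, hR, hR']
      simp
  have h10 : Approximates (levyApprox R) (gen R 1 τ ⊗ₜ[ℝ] gen R 0 σ) := by
    obtain ⟨w, hw⟩ := exists_hasRSIntegral₁_fbmCov (continuous_fbmCov_left ha' τ) ha σ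
    refine approximates_of_self (w := -w) ?_ ?_
    · rw [hR, hR', levyKernel_one_zero]
      exact (hasQuadIntegral_levyKernel ha' ha ha2 τ σ hw).neg_left
    · refine ((hw.tendsto_uniform (ν := fun N k => (uniform N).pt (k + 1)) fun N k _ =>
        ⟨(uniform N).mono (Nat.le_succ k), le_rfl⟩).neg).congr fun N => ?_
      rw [inner_levyApprox]
      simp only [inner_levyFst, inner_levySnd, hR, hR']
      simp only [if_true, one_ne_zero, zero_ne_one, if_false, zero_mul, zero_add]
      -- The pairing now has the increments on the other covariance. Summation by parts turns it
      -- into minus the Riemann sum with right endpoints; the shifts by half the final values make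
      -- the boundary term at 1 equal to `1 - 1/2 - 1/2` times a product, and that at 0 vanishes.
      rw [neg_eq_iff_add_eq_zero, ← Finset.sum_add_distrib]
      set u := (uniform N).pt with hu
      have e : ∀ k, (fbmCov a' (u (k + 1)) τ - fbmCov a' 1 τ / 2) *
          (fbmCov a (u (k + 1)) σ - fbmCov a (u k) σ) +
          (fbmCov a' (u (k + 1)) τ - fbmCov a' (u k) τ) *
          (fbmCov a (u k) σ - fbmCov a 1 σ / 2) =
          (fbmCov a' (u (k + 1)) τ * fbmCov a (u (k + 1)) σ -
            fbmCov a' 1 τ * fbmCov a (u (k + 1)) σ / 2 -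
            fbmCov a' (u (k + 1)) τ * fbmCov a 1 σ / 2) -
          (fbmCov a' (u k) τ * fbmCov a (u k) σ - fbmCov a' 1 τ * fbmCov a (u k) σ / 2 -
            fbmCov a' (u k) τ * fbmCov a 1 σ / 2) := fun k => by ring
      rw [Finset.sum_congr rfl fun k _ => e k, Finset.sum_range_sub (fun k =>
        fbmCov a' (u k) τ * fbmCov a (u k) σ - fbmCov a' 1 τ * fbmCov a (u k) σ / 2 -
            fbmCov a' (u k) τ * fbmCov a 1 σ / 2)]
      have e1 : u (N + 1) = 1 := (uniform N).last
      have e0 : u 0 = 0 := (uniform N).first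
      rw [e1, e0, fbmCov_zero_left ha, fbmCov_zero_left ha']
      ring
  fin_cases i <;> fin_cases j
  · exact same 0
  · exact h01
  · exact h10
  · exact same 1

include ha ha2 ha' ha2' hR hR' in
/-- The Lévy kernel is represented by an element of the symmetric tensor square. -/
theorem exists_representsLevyKernel (h : 1 < a + a') :
    ∃ f : HilTensor R, RepresentsLevyKernel f := by
  obtain ⟨C, hC⟩ := exists_norm_levyApprox_le (R := R) ha ha' ha2' hR hR' h
  obtain ⟨f, hf, hlim⟩ := exists_weak_limit isClosed_symTensor (levyApprox_mem (R := R)) hC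
  refine ⟨f, hf, fun g => ?_⟩
  obtain ⟨w, h1, h2⟩ := approximates_levyApprox ha ha2 ha' ha2' hR hR' g
  exact ⟨w, h1, hlim _ _ h2⟩

end Fbm

/-! ### Generalised Lévy areas of fractional Brownian motions -/

variable {Ω : Type*} [MeasurableSpace Ω] {P : Measure Ω}

lemma IsFractionalBrownianMotion.covariance_eq {H : ℝ} {X : Time → Ω → ℝ}
    (hX : IsFractionalBrownianMotion H P X) :
    (fun s t => cov[X s, X t; P]) = fbmCov (2 * H) := by
  funext s t
  exact hX.cov s t

/-- A generalised Lévy area of independent fractional Brownian motions exists if the sum of the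
Hurst parameters is greater than `1/2`. -/
theorem hasGeneralisedLevyArea [IsProbabilityMeasure P] {H H' : ℝ} (hH : H ∈ Set.Ioo (0 : ℝ) 1) (hH' : H' ∈ Set.Ioo (0 : ℝ) 1)
    {X Y : Time → Ω → ℝ} (hX : IsFractionalBrownianMotion H P X)
    (hY : IsFractionalBrownianMotion H' P Y)
    (hXY : IndepFun (fun ω t => X t ω) (fun ω t => Y t ω) P) (h : 1 / 2 < H + H') :
    HasGeneralisedLevyArea P X Y := by
  have hG : ∀ i, IsGaussianProcess ((![X, Y] : Fin 2 → Time → Ω → ℝ) i) P := by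
    intro i
    fin_cases i
    exacts [hX.gaussian, hY.gaussian]
  have h0 : ∀ i t, ∫ ω, (![X, Y] : Fin 2 → Time → Ω → ℝ) i t ω ∂P = 0 := by
    intro i
    fin_cases i
    exacts [hX.centered, hY.centered]
  have hm : ∀ i t, MemLp ((![X, Y] : Fin 2 → Time → Ω → ℝ) i t) 2 P := fun i t =>
    ((hG i).hasGaussianLaw_eval t).memLp_two
  obtain ⟨W, hW⟩ := exists_isIsonormal hm hG h0 hXY
  obtain ⟨I₂, hI⟩ := exists_isDoubleIntegral (W := W) hW.gaussian
  obtain ⟨f, hf⟩ := exists_representsLevyKernel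
    (R := fun i => covFun P ((![X, Y] : Fin 2 → Time → Ω → ℝ) i) (hm i))
    (a := 2 * H) (a' := 2 * H') (by linarith [hH.1]) (by linarith [hH.2]) (by linarith [hH'.1])
    (by linarith [hH'.2]) hX.covariance_eq hY.covariance_eq (by linarith)
  exact ⟨I₂ f, hm, W, I₂, f, hW, hI, hf, rfl⟩

lemma one_div_max_one_one_div {a : ℝ} (ha : 0 < a) : 1 / max 1 (1 / a) = min 1 a := by
  rcases le_total a 1 with h | h
  · rw [min_eq_right h, max_eq_right ((one_le_div ha).2 h), one_div_one_div]
  · rw [min_eq_left h, max_eq_left ((div_le_one ha).2 h), div_one]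

lemma one_lt_min_add_min_iff {a b : ℝ} (ha : 0 < a) (hb : 0 < b) :
    1 < min 1 a + min 1 b ↔ 1 < a + b := by
  refine ⟨fun h => h.trans_le (add_le_add (min_le_right _ _) (min_le_right _ _)), fun h => ?_⟩
  rcases min_cases 1 a with h1 | h1 <;> rcases min_cases 1 b with h2 | h2 <;> linarith

end

end LevyArea

theorem mainTheorem3 {Ω : Type*} [MeasurableSpace Ω] (P : Measure Ω) [IsProbabilityMeasure P]
    (H H' : ℝ) (hH : H ∈ Set.Ioo (0 : ℝ) 1) (hH' : H' ∈ Set.Ioo (0 : ℝ) 1)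
    (X Y : LevyArea.Time → Ω → ℝ)
    (hX : LevyArea.IsFractionalBrownianMotion H P X)
    (hY : LevyArea.IsFractionalBrownianMotion H' P Y)
    (hXY : IndepFun (fun ω t => X t ω) (fun ω t => Y t ω) P) :
    -- the covariance functions have finite variation of order `max 1 (1 / (2 H))`
    LevyArea.HasFinitePVariation (max 1 (1 / (2 * H))) (fun s t => cov[X s, X t; P]) ∧
    LevyArea.HasFinitePVariation (max 1 (1 / (2 * H'))) (fun s t => cov[Y s, Y t; P]) ∧
    -- for these orders the condition on the exponents means `H + H' > 1 / 2`
    (1 < 1 / max 1 (1 / (2 * H)) + 1 / max 1 (1 / (2 * H')) ↔ 1 / 2 < H + H') ∧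
    -- existence under the condition on the variation exponents
    (∀ p q : ℝ, 1 ≤ p → 1 ≤ q →
      LevyArea.HasFinitePVariation p (fun s t => cov[X s, X t; P]) →
      LevyArea.HasFinitePVariation q (fun s t => cov[Y s, Y t; P]) →
      1 < 1 / p + 1 / q → LevyArea.HasGeneralisedLevyArea P X Y) ∧
    -- existence in terms of the Hurst parameters
    (1 / 2 < H + H' → LevyArea.HasGeneralisedLevyArea P X Y) ∧
    (H = H' → 1 / 4 < H → LevyArea.HasGeneralisedLevyArea P X Y) ∧
    -- one process may be arbitrarily irregular if the other one is regular enough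
    (H < 1 / 2 → 1 / 2 - H < H' → LevyArea.HasGeneralisedLevyArea P X Y) := by
  have ha : 0 < 2 * H := by linarith [hH.1]
  have ha' : 0 < 2 * H' := by linarith [hH'.1]
  have main : 1 / 2 < H + H' → LevyArea.HasGeneralisedLevyArea P X Y :=
    LevyArea.hasGeneralisedLevyArea hH hH' hX hY hXY
  rw [hX.covariance_eq, hY.covariance_eq]
  refine ⟨LevyArea.hasFinitePVariation_fbmCov ha (by linarith [hH.2]),
    LevyArea.hasFinitePVariation_fbmCov ha' (by linarith [hH'.2]), ?_, ?_, main,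
    fun h1 h2 => main (by linarith), fun h1 h2 => main (by linarith)⟩
  · rw [LevyArea.one_div_max_one_one_div ha, LevyArea.one_div_max_one_one_div ha',
      LevyArea.one_lt_min_add_min_iff ha ha']
    constructor <;> intro h <;> linarith
  · intro p q hp hq hpX hqY h
    -- Since `1/p ≤ 2H` and `1/q ≤ 2H'`, the hypothesis on the exponents already implies `H + H' >
    -- 1/2`.
    have h1 := LevyArea.one_le_mul_of_hasFinitePVariation ha hp hpX
    have h2 := LevyArea.one_le_mul_of_hasFinitePVariation ha' hq hqY
    have e1 : 1 / p ≤ 2 * H := (div_le_iff₀ (by linarith)).2 h1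
    have e2 : 1 / q ≤ 2 * H' := (div_le_iff₀ (by linarith)).2 h2
    exact main (by linarith)
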